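/- Fix a finite alphabet $\Sigma$. A timed word is a finite sequence $(t_1\cdot a_1)\cdots(t_n\cdot a_n)$ of delays $t_i\in\mathbb{R}_{\ge 0}$ and letters $a_i\in\Sigma$; $\mathbb{T}\Sigma^*$ is the set of timed words, a (timed) language is a set $L\subseteq\mathbb{T}\Sigma^*$, and $u^{-1}L=\{w\mid uw\in L\}$. A one-clock timed automaton has finitely many states, an initial state, final states, and finitely many transitions $(q,q',a,\varphi,r)$ whose guard $\varphi$ is a conjunction of constraints $c<x$, $x=c$, $x<c$ ($c\in\mathbb{N}$) on the single clock $x$ and whose bit $r\in\{0,1\}$ says whether the clock is reset ($r=0$) or not ($r=1$). It is deterministic (a 1-DTA) if two distinct transitions with the same source and letter have disjoint guards, and complete if every timed word has exactly one run from the initial state with clock value $0$. $L$ is 1-DTA recognizable if it is the language of a 1-DTA. The (maximum) constant of an automaton is the largest constant in its guards ($0$ if there is none). For $y,z\ge 0$ write $y\equiv z$ if $\lfloor y\rfloor=\lfloor z\rfloor$ and ($\{y\}=0\Leftrightarrow\{z\}=0$), and $y\equiv^K z$ if $y\equiv z$ or both $y,z>K$ (for $K=\infty$, $\equiv^\infty$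 is $\equiv$). The classes of $\equiv^K$, $K\in\mathbb{N}$, are the $K$-regions. An acceptor is a complete 1-DTA, with maximum constant $K$, such that every guard denotes a $K$-region and each state $q$ is associated with a $K$-region that contains the clock value of every timed word reaching $q$. It is strict if every transition whose guard is an equality $x=n$ resets the clock. A reset function is a map $R:\mathbb{T}\Sigma^*\to\mathbb{R}_{\ge 0}$ with $R(\epsilon)=0$ and $R(u(t\cdot a))\in\{0,R(u)+t\}$. A timed word is half-integral if all its delays are of the form $m/2$, $m\in\mathbb{N}$; $\mathcal{HI}$ is the set of half-integral words. Let $\mathit{hi}(x)=x$ if $x\in\mathbb{N}$ and $\mathit{hi}(x)=\lfloor x\rfloor+\frac12$ otherwise. The normal form with respect to $R$ is given by $N^R(\epsilon)=\epsilon$ and $N^R(u(t\cdot a))=N^R(u)(t'\cdot a)$, where $t'=\frac n2$, $n\in\mathbb{N}$, is such that $R(u)+t\equiv \mathit{hi}(R(u))+t'$. A profile is a pair $(R,\approx)$ of a reset function and an equivalence relation on $\mathcal{HI}$. Let $K_{(R,\approx)}\in\mathbb{N}\cup\{\infty\}$ be the least $K\in\mathbb{N}$ such that, for all $u\in\mathcal{HI}$,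 $a\in\Sigma$, $n\in\mathbb{N}$, $R(u)+\frac n2>K$ implies $u(\frac n2\cdot a)\approx u(K+\frac12\cdot a)$, and $\infty$ if there is no such $K$. The profile * is $L$-preserving if $u\approx v$ implies ($u\in L\Leftrightarrow v\in L$) for $u,v\in\mathcal{HI}$, and $w\in L\Leftrightarrow N^R(w)\in L$ for every $w\in\mathbb{T}\Sigma^*$; * is monotonic if for $u,v\in\mathcal{HI}$, $u\approx v$ implies $R(u)\equiv^{K_{(R,\approx)}}R(v)$ and $u(\frac n2\cdot a)\approx v(\frac n2\cdot a)$ for all $n\in\mathbb{N}$, $a\in\Sigma$, and moreover $R(u)\equiv R(N^R(u))$ for every $u\in\mathbb{T}\Sigma^*$; * has finite index if $\approx$ has finitely many classes and $K_{(R,\approx)}<\infty$. The syntactic reset function $\mathbf{R}^L$ of $L$ is defined by $\mathbf{R}^L(\epsilon)=0$, and $\mathbf{R}^L(u(t\cdot a))=0$ if $(u(t\cdot a))^{-1}L$ is 1-DTA recognizable, $\mathbf{R}^L(u(t\cdot a))=\mathbf{R}^L(u)+t$ otherwise. For $u,v\in\mathcal{HI}$, $u\approx^L v$ means $\mathbf{R}^L(u)=\mathbf{R}^L(v)$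 and $u^{-1}L=v^{-1}L$. The pair $(\mathbf{R}^L,\approx^L)$ is the syntactic profile of $L$. The canonical acceptor $\mathcal{A}_{(\mathbf{R}^L,\approx^L)}$ has as states the classes $[u]$ of $\approx^L$, initial state $[\epsilon]$, final states $[u]$ for $u\in L\cap\mathcal{HI}$, and a transition $([u],[v],a,g,s)$ whenever for some $n\in\mathbb{N}$ we have $u(\frac n2\cdot a)\approx^L v$, $g$ is the constraint describing the $K$-region of $\mathbf{R}^L(u)+\frac n2$ with $K=K_{(\mathbf{R}^L,\approx^L)}$ (that is, $x=t$, or $\lfloor t\rfloor<x<\lceil t\rceil$, or $K<x$, where $t=\mathbf{R}^L(u)+\frac n2$), and $s=0$ if $\mathbf{R}^L(v)=0$, $s=1$ otherwise. **Theorem.** For every language $L\subseteq\mathbb{T}\Sigma^*$: (a) $L$ is 1-DTA recognizable if and only if its syntactic profile $(\mathbf{R}^L,\approx^L)$ is $L$-preserving, monotonic and has finite index. (b) If $L$ is 1-DTA recognizable, then $\mathcal{A}_{(\mathbf{R}^L,\approx^L)}$ is a strict acceptor with language $L$; and no strict acceptor for $L$ has fewer states, or a smaller constant, than $\mathcal{A}_{(\mathbf{R}^L,\approx^L)}$.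 -/

import Mathlib

open scoped NNReal

namespace OneClock

/-! ### Timed words and timed languages -/

/-- A timed word `(t₁·a₁)…(tₙ·aₙ)`: a finite sequence of pairs (delay, letter). -/
abbrev TimedWord (α : Type*) := List (ℝ≥0 × α)

/-- The residual language `u⁻¹L = {w | uw ∈ L}`. -/
def residual {α : Type*} (u : TimedWord α) (L : Set (TimedWord α)) : Set (TimedWord α) :=
  {w | u ++ w ∈ L}

/-! ### Clock constraints and one-clock timed automata -/

/-- Clock constraints `φ ::= c < x | x = c | x < c | φ ∧ φ` with `c ∈ ℕ`. -/
inductive ClockConstraint : Type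
  | gt (c : ℕ) : ClockConstraint
  | eq (c : ℕ) : ClockConstraint
  | lt (c : ℕ) : ClockConstraint
  | and (φ ψ : ClockConstraint) : ClockConstraint

/-- The set `⟦φ⟧` of clock values that satisfy `φ`. -/
def ClockConstraint.denote : ClockConstraint → Set ℝ≥0
  | .gt c => {x | (c : ℝ≥0) < x}
  | .eq c => {x | x = (c : ℝ≥0)}
  | .lt c => {x | x < (c : ℝ≥0)}
  | .and φ ψ => φ.denote ∩ ψ.denote

/-- The largest constant that appears in a clock constraint. -/
def ClockConstraint.maxConst : ClockConstraint → ℕ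
  | .gt c => c
  | .eq c => c
  | .lt c => c
  | .and φ ψ => max φ.maxConst ψ.maxConst

/-- A transition `(q, q', a, φ, r)`; `resets = true` stands for `r = 0` (the clock is reset), and
`resets = false` for `r = 1` (the clock is not reset). -/
structure Transition (α Q : Type*) where
  source : Q
  target : Q
  letter : α
  guard : ClockConstraint
  resets : Bool

/-- The data `(Q, q_I, T, F)` of a one-clock timed automaton over `α`. Finiteness of `Q` and `T` is
imposed in `IsDTA`. -/
structure TA (α Q : Type*) where
  init : Q
  trans : Set (Transition α Q)
  final : Set Q

namespace TA

variable {α Q : Type*}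

/-- `A.IsRun c w e c'`: the sequence `e` of transitions is a run of `A` on `w` from the
configuration `c` to the configuration `c'`. -/
inductive IsRun (A : TA α Q) :
    Q × ℝ≥0 → TimedWord α → List (Transition α Q) → Q × ℝ≥0 → Prop
  | nil (c : Q × ℝ≥0) : IsRun A c [] [] c
  | cons (θ : Transition α Q) (ν t : ℝ≥0) (w : TimedWord α) (e : List (Transition α Q))
      (c' : Q × ℝ≥0) (hθ : θ ∈ A.trans) (hguard : ν + t ∈ θ.guard.denote)
      (hrun : IsRun A (θ.target, if θ.resets = true then 0 else ν + t) w e c') :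
      IsRun A (θ.source, ν) ((t, θ.letter) :: w) (θ :: e) c'

/-- The language `𝓛(A)`: the words with an accepting run from the initial configuration. -/
def language (A : TA α Q) : Set (TimedWord α) :=
  {w | ∃ e q ν, A.IsRun (A.init, 0) w e (q, ν) ∧ q ∈ A.final}

/-- Two distinct transitions differ in their source, or in their letter, or have disjoint guards. -/
def Deterministic (A : TA α Q) : Prop :=
  ∀ θ ∈ A.trans, ∀ θ' ∈ A.trans, θ ≠ θ' →
    θ.source ≠ θ'.source ∨ θ.letter ≠ θ'.letter ∨ θ.guard.denote ∩ θ'.guard.denote = ∅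

/-- Every timed word has exactly one run from the initial configuration. -/
def Complete (A : TA α Q) : Prop :=
  ∀ w, ∃! e, ∃ c, A.IsRun (A.init, 0) w e c

/-- The largest constant that appears in the transitions of `A` (`0` if there is none). -/
noncomputable def maxConst (A : TA α Q) : ℕ :=
  sSup ((fun θ : Transition α Q => θ.guard.maxConst) '' A.trans)

/-- `A` is a one-clock deterministic timed automaton (1-DTA). -/
structure IsDTA (A : TA α Q) : Prop where
  finite_states : Finite Q
  finite_trans : A.trans.Finite
  deterministic : A.Deterministic

end TA

/-- `L` is 1-DTA recognizable. -/
def Recognizable {α : Type*} (L : Set (TimedWord α)) : Prop :=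
  ∃ (Q : Type) (A : TA α Q), A.IsDTA ∧ A.language = L

/-! ### Region equivalence -/

/-- The fractional part of a non-negative real. -/
noncomputable def frac (y : ℝ≥0) : ℝ≥0 := y - (⌊y⌋₊ : ℝ≥0)

/-- `y ≡ z`: same integral part, and the fractional parts are both zero or both nonzero. -/
def RegionEq (y z : ℝ≥0) : Prop := ⌊y⌋₊ = ⌊z⌋₊ ∧ (frac y = 0 ↔ frac z = 0)

/-- `y ≡^K z`: `y ≡ z`, or both lie strictly above `K`. For `K = ∞` this is `y ≡ z`. -/
def RegionEqK (K : ℕ∞) (y z : ℝ≥0) : Prop :=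
  RegionEq y z ∨ ∃ k : ℕ, K = (k : ℕ∞) ∧ (k : ℝ≥0) < y ∧ (k : ℝ≥0) < z

/-- A `K`-region: a class of `≡^K`. -/
def IsRegion (K : ℕ) (S : Set ℝ≥0) : Prop := ∃ y, S = {z | RegionEqK (K : ℕ∞) y z}

/-! ### Acceptors -/

namespace TA

variable {α Q : Type*}

/-- `A` is a `K`-acceptor, `K` being its maximum constant: a complete 1-DTA whose guards denote
`K`-regions and each of whose states `q` comes with a `K`-region that contains the clock value of
every timed word that reaches `q`. -/
structure IsAcceptor (A : TA α Q) : Prop where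
  isDTA : A.IsDTA
  complete : A.Complete
  guard_region : ∀ θ ∈ A.trans, IsRegion A.maxConst θ.guard.denote
  state_region : ∃ region : Q → Set ℝ≥0, (∀ q, IsRegion A.maxConst (region q)) ∧
    ∀ u e q y, A.IsRun (A.init, 0) u e (q, y) → y ∈ region q

/-- A strict acceptor: every transition with an equality guard `x = n` resets the clock. -/
structure IsStrictAcceptor (A : TA α Q) : Prop extends IsAcceptor A where
  strict : ∀ θ ∈ A.trans, ∀ n : ℕ, θ.guard.denote = {(n : ℝ≥0)} → θ.resets = true

end TA

/-! ### Half-integral values and words -/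

/-- The word `w` is half-integral: every delay is of the form `m / 2` with `m ∈ ℕ`. -/
def IsHalfIntegral {α : Type*} (w : TimedWord α) : Prop :=
  ∀ p ∈ w, ∃ m : ℕ, p.1 = (m : ℝ≥0) / 2

/-- The half-integral words. -/
abbrev HIWord (α : Type*) := {w : TimedWord α // IsHalfIntegral w}

/-- The empty word. -/
def HIWord.nil {α : Type*} : HIWord α := ⟨[], by intro p hp; simp at hp⟩

/-- The half-integral word `u (n/2 · a)`. -/
noncomputable def HIWord.snoc {α : Type*} (u : HIWord α) (n : ℕ) (a : α) : HIWord α :=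
  ⟨u.1 ++ [((n : ℝ≥0) / 2, a)], by
    intro p hp
    rcases List.mem_append.1 hp with h | h
    · exact u.2 p h
    · exact ⟨n, by rw [List.mem_singleton.1 h]⟩⟩

open Classical in
/-- `hi x` is `x` if the fractional part of `x` is zero and `⌊x⌋ + 1/2` otherwise. -/
noncomputable def hi (x : ℝ≥0) : ℝ≥0 :=
  if frac x = 0 then x else (⌊x⌋₊ : ℝ≥0) + 1 / 2

/-! ### Reset functions -/

/-- `R` is a reset function: `R(ε) = 0`, and `R(u(t·a))` is `0` or `R(u) + t`. -/
def IsResetFunction {α : Type*} (R : TimedWord α → ℝ≥0) : Prop :=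
  R [] = 0 ∧ ∀ u t a, R (u ++ [(t, a)]) = 0 ∨ R (u ++ [(t, a)]) = R u + t

open Classical in
/-- The clock value after reading a word when the remaining language is `L`, the current clock
value is `y`, and the clock is reset exactly when the residual is 1-DTA recognizable. -/
noncomputable def syntacticResetFrom {α : Type*} :
    Set (TimedWord α) → ℝ≥0 → TimedWord α → ℝ≥0
  | _, y, [] => y
  | L, y, (t, a) :: w =>
    syntacticResetFrom (residual [(t, a)] L)
      (if Recognizable (residual [(t, a)] L) then 0 else y + t) w

/-- The syntactic reset function `R^L`. -/
noncomputable def syntacticReset {α : Type*} (L : Set (TimedWord α)) (u : TimedWord α) : ℝ≥0 :=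
  syntacticResetFrom L 0 u

open Classical in
theorem syntacticResetFrom_snoc {α : Type*} (u : TimedWord α) (t : ℝ≥0) (a : α) :
    ∀ (L : Set (TimedWord α)) (y : ℝ≥0), syntacticResetFrom L y (u ++ [(t, a)]) =
      if Recognizable (residual (u ++ [(t, a)]) L) then 0 else syntacticResetFrom L y u + t := by
  induction u with
  | nil => intro L y; rfl
  | cons p u ih => intro L y; exact ih _ _

theorem syntacticReset_nil {α : Type*} (L : Set (TimedWord α)) : syntacticReset L [] = 0 := rfl

open Classical in
/-- The inductive definition of `R^L`, prefix by prefix. -/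
theorem syntacticReset_snoc {α : Type*} (L : Set (TimedWord α)) (u : TimedWord α) (t : ℝ≥0)
    (a : α) : syntacticReset L (u ++ [(t, a)]) =
      if Recognizable (residual (u ++ [(t, a)]) L) then 0 else syntacticReset L u + t :=
  syntacticResetFrom_snoc u t a L 0

theorem isResetFunction_syntacticReset {α : Type*} (L : Set (TimedWord α)) :
    IsResetFunction (syntacticReset L) := by
  refine ⟨syntacticReset_nil L, fun u t a => ?_⟩
  rw [syntacticReset_snoc]
  split_ifs
  · exact Or.inl rfl
  · exact Or.inr rfl

/-! ### Normal forms -/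

/-- The normal form of the last part of a word of which the prefix `u` has already been read. -/
noncomputable def normalFormFrom {α : Type*} (R : TimedWord α → ℝ≥0) :
    TimedWord α → TimedWord α → TimedWord α
  | _, [] => []
  | u, (t, a) :: w => (hi (R u + t) - hi (R u), a) :: normalFormFrom R (u ++ [(t, a)]) w

/-- The normal form `N^R(u)`: `N^R(ε) = ε` and `N^R(u(t·a)) = N^R(u)(t'·a)`, where `t'` is the
half-integral delay with `R(u) + t ≡ hi(R(u)) + t'`, that is, `t' = hi(R(u) + t) - hi(R(u))`. -/
noncomputable def normalForm {α : Type*} (R : TimedWord α → ℝ≥0) (u : TimedWord α) :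
    TimedWord α :=
  normalFormFrom R [] u

theorem normalForm_nil {α : Type*} (R : TimedWord α → ℝ≥0) : normalForm R [] = [] := rfl

theorem normalForm_snoc {α : Type*} (R : TimedWord α → ℝ≥0) (u : TimedWord α) (t : ℝ≥0) (a : α) :
    normalForm R (u ++ [(t, a)]) = normalForm R u ++ [(hi (R u + t) - hi (R u), a)] := by
  have key : ∀ (w v : TimedWord α), normalFormFrom R v (w ++ [(t, a)]) =
      normalFormFrom R v w ++ [(hi (R (v ++ w) + t) - hi (R (v ++ w)), a)] := by
    intro w
    induction w with
    | nil => intro v; simp [normalFormFrom]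
    | cons p w ih => intro v; simp [normalFormFrom, ih]
  simpa [normalForm] using key u []

/-- `hi x` is a half-integer. -/
theorem hi_eq_half (x : ℝ≥0) : ∃ n : ℕ, hi x = (n : ℝ≥0) / 2 := by
  unfold hi
  split_ifs with h
  · refine ⟨2 * ⌊x⌋₊, ?_⟩
    have h1 : x ≤ (⌊x⌋₊ : ℝ≥0) := tsub_eq_zero_iff_le.1 h
    have h2 : x = (⌊x⌋₊ : ℝ≥0) := le_antisymm h1 (Nat.floor_le (by positivity))
    push_cast
    rw [← h2]
    field_simp
  · refine ⟨2 * ⌊x⌋₊ + 1, ?_⟩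
    push_cast
    field_simp

theorem hi_mono {x y : ℝ≥0} (h : x ≤ y) : hi x ≤ hi y := by
  have hf : ⌊x⌋₊ ≤ ⌊y⌋₊ := Nat.floor_mono h
  have hf' : (⌊x⌋₊ : ℝ≥0) ≤ (⌊y⌋₊ : ℝ≥0) := by exact_mod_cast hf
  have hfy : (⌊y⌋₊ : ℝ≥0) ≤ y := Nat.floor_le (by positivity)
  unfold hi
  split_ifs with h1 h2 h2
  · exact h
  · have : x ≤ (⌊x⌋₊ : ℝ≥0) := tsub_eq_zero_iff_le.1 h1
    exact (this.trans hf').trans le_self_add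
  · have h3 : ¬ x ≤ (⌊x⌋₊ : ℝ≥0) := fun h => h1 (tsub_eq_zero_iff_le.2 h)
    have h4 : y ≤ (⌊y⌋₊ : ℝ≥0) := tsub_eq_zero_iff_le.1 h2
    have h5 : ⌊x⌋₊ < ⌊y⌋₊ := by
      have : (⌊x⌋₊ : ℝ≥0) < (⌊y⌋₊ : ℝ≥0) := (not_le.1 h3).trans_le (h.trans h4)
      exact_mod_cast this
    have h6 : ((⌊x⌋₊ + 1 : ℕ) : ℝ≥0) ≤ (⌊y⌋₊ : ℝ≥0) := by exact_mod_cast h5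
    refine le_trans ?_ (h6.trans hfy)
    push_cast
    gcongr
    rw [← NNReal.coe_le_coe]
    norm_num
  · gcongr

theorem regionEq_hi (x : ℝ≥0) : RegionEq x (hi x) := by
  unfold hi
  split_ifs with h
  · exact ⟨rfl, Iff.rfl⟩
  · have h2 : ⌊(⌊x⌋₊ : ℝ≥0) + 1 / 2⌋₊ = ⌊x⌋₊ := by
      rw [Nat.floor_eq_iff (by positivity)]
      refine ⟨le_self_add, ?_⟩
      rw [← NNReal.coe_lt_coe]
      push_cast
      norm_num
    refine ⟨h2.symm, iff_of_false h ?_⟩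
    unfold frac
    rw [h2, add_tsub_cancel_left]
    norm_num

/-- The delay `t'` used in the normal form is the one prescribed: `t' = n/2` for some `n ∈ ℕ`, and
`R(u) + t ≡ hi(R(u)) + t'`. -/
theorem normalForm_delay_spec (r t : ℝ≥0) :
    (∃ n : ℕ, hi (r + t) - hi r = (n : ℝ≥0) / 2) ∧
      RegionEq (r + t) (hi r + (hi (r + t) - hi r)) := by
  have hle : hi r ≤ hi (r + t) := hi_mono le_self_add
  refine ⟨?_, ?_⟩
  · obtain ⟨m, hm⟩ := hi_eq_half (r + t)
    obtain ⟨n, hn⟩ := hi_eq_half r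
    refine ⟨m - n, ?_⟩
    rw [hm, hn, Nat.cast_tsub, NNReal.sub_div]
  · rw [add_tsub_cancel_of_le hle]
    exact regionEq_hi _

/-! ### Profiles -/

/-- A profile `(R, ≈)`: a reset function and an equivalence relation on half-integral words. -/
structure Profile (α : Type*) where
  R : TimedWord α → ℝ≥0
  isReset : IsResetFunction R
  rel : Setoid (HIWord α)

namespace Profile

variable {α : Type*}

/-- The property `C(K)`: for all half-integral `u`, all letters `a` and all `n ∈ ℕ`, if
`R(u) + n/2 > K` then `u(n/2 · a) ≈ u(K + 1/2 · a)`; here `K + 1/2 = (2K + 1)/2`. -/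
def C (P : Profile α) (K : ℕ) : Prop :=
  ∀ (u : HIWord α) (a : α) (n : ℕ), (K : ℝ≥0) < P.R u.1 + (n : ℝ≥0) / 2 →
    P.rel (u.snoc n a) (u.snoc (2 * K + 1) a)

/-- The constant `K_(R,≈)`: the least `K` with `C(K)`, and `∞` if there is none. -/
noncomputable def constant (P : Profile α) : ℕ∞ := sInf ((fun K : ℕ => (K : ℕ∞)) '' {K | P.C K})

/-- `(R, ≈)` is `L`-preserving. -/
structure Preserving (P : Profile α) (L : Set (TimedWord α)) : Prop where
  mem_iff_of_rel : ∀ u v : HIWord α, P.rel u v → (u.1 ∈ L ↔ v.1 ∈ L)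
  mem_iff_normalForm : ∀ w : TimedWord α, w ∈ L ↔ normalForm P.R w ∈ L

/-- `(R, ≈)` has finite index: `≈` has finitely many classes and `K_(R,≈) < ∞`. -/
structure FiniteIndex (P : Profile α) : Prop where
  finite_quotient : Finite (Quotient P.rel)
  constant_lt_top : P.constant < ⊤

/-- `(R, ≈)` is monotonic. -/
structure Monotonic (P : Profile α) : Prop where
  regionEq : ∀ u v : HIWord α, P.rel u v → RegionEqK P.constant (P.R u.1) (P.R v.1)
  snoc : ∀ u v : HIWord α, P.rel u v → ∀ (n : ℕ) (a : α), P.rel (u.snoc n a) (v.snoc n a)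
  regionEq_normalForm : ∀ u : TimedWord α, RegionEq (P.R u) (P.R (normalForm P.R u))

end Profile

open Classical in
/-- The clock constraint `φ_K(t)` that denotes the `K`-region of `t`. -/
noncomputable def regionGuard (K : ℕ) (t : ℝ≥0) : ClockConstraint :=
  if t ≤ (K : ℝ≥0) then
    if frac t = 0 then .eq ⌊t⌋₊ else .and (.gt ⌊t⌋₊) (.lt ⌈t⌉₊)
  else .gt K

/-- The automaton `A_(R,≈)` of a profile, for the language `L`. Its states are the classes `[u]`.
There is a transition `([u], [v], a, φ_K(R(u) + n/2), s)` whenever `u(n/2 · a) ≈ v`; it resets the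
clock iff `R(v) = 0`. Here `K = K_(R,≈)`, which is finite in all cases of interest. -/
noncomputable def Profile.automaton {α : Type*} (P : Profile α) (L : Set (TimedWord α)) :
    TA α (Quotient P.rel) where
  init := Quotient.mk P.rel HIWord.nil
  trans := {θ | ∃ (u v : HIWord α) (n : ℕ),
    P.rel (u.snoc n θ.letter) v ∧
    θ.source = Quotient.mk P.rel u ∧
    θ.target = Quotient.mk P.rel v ∧
    θ.guard = regionGuard P.constant.toNat (P.R u.1 + (n : ℝ≥0) / 2) ∧
    (θ.resets = true ↔ P.R v.1 = 0)}
  final := {q | ∃ u : HIWord α, u.1 ∈ L ∧ q = Quotient.mk P.rel u}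

/-- The syntactic profile `(R^L, ≈^L)`: `u ≈^L v` iff `R^L(u) = R^L(v)` and `u⁻¹L = v⁻¹L`. -/
noncomputable def syntacticProfile {α : Type*} (L : Set (TimedWord α)) : Profile α where
  R := syntacticReset L
  isReset := isResetFunction_syntacticReset L
  rel :=
    { r := fun u v => syntacticReset L u.1 = syntacticReset L v.1 ∧ residual u.1 L = residual v.1 L
      iseqv :=
        { refl := fun _ => ⟨rfl, rfl⟩
          symm := fun h => ⟨h.1.symm, h.2.symm⟩
          trans := fun h h' => ⟨h.1.trans h'.1, h.2.trans h'.2⟩ } }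

/-- The states of the canonical acceptor: the classes of `≈^L`. -/
abbrev CanonicalState {α : Type*} (L : Set (TimedWord α)) := Quotient (syntacticProfile L).rel

/-- The canonical acceptor `A_(R^L,≈^L)`. -/
noncomputable def canonicalAcceptor {α : Type*} (L : Set (TimedWord α)) :
    TA α (CanonicalState L) :=
  (syntacticProfile L).automaton L

end OneClock

/-!
In a 1-DTA the residual `u⁻¹L` depends on the state and the clock value `y` reached by `u` only. It
is recognizable if `y` is an integer or exceeds the maximum constant. Conversely, a recognizable
residual is the same for all clock values in the region of `y`: compare the automaton at `y` with a
recognizer of the residual that starts at `0`; the region of the pair of clocks `(y, 0)` is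
determined by the region of `y`, and two-clock region equivalence is a bisimulation. So no
information is lost by resetting the clock as soon as the residual is recognizable, as `R^L` does:
normal forms stay in `L` or outside of it, and `R^L` never exceeds the maximum constant, so that
`≈^L` has finite index.

For minimality, in a strict acceptor the clock agrees with `R^L` on all half-integral words with an
unrecognizable residual. As each state lives in one region, half-integral words that reach the same
state are therefore equivalent under `≈^L`.
-/

namespace OneClock

/-! ### Regions -/

section Regions

variable {x y z t : ℝ≥0} {k n : ℕ}

theorem frac_eq_zero_iff_ceil_le_floor : frac y = 0 ↔ ⌈y⌉₊ ≤ ⌊y⌋₊ :=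
  tsub_eq_zero_iff_le.trans Nat.ceil_le.symm

theorem eq_floor_of_frac_eq_zero (h : frac y = 0) : y = (⌊y⌋₊ : ℝ≥0) :=
  le_antisymm (tsub_eq_zero_iff_le.1 h) (Nat.floor_le zero_le)

theorem ceil_eq_floor_add_one_of_frac_ne_zero (h : frac y ≠ 0) : ⌈y⌉₊ = ⌊y⌋₊ + 1 :=
  le_antisymm (Nat.ceil_le_floor_add_one y) (Nat.lt_ceil.2 (not_le.1 (mt tsub_eq_zero_iff_le.2 h)))

theorem regionEq_iff_floor_ceil : RegionEq y z ↔ ⌊y⌋₊ = ⌊z⌋₊ ∧ ⌈y⌉₊ = ⌈z⌉₊ := by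
  have := Nat.floor_le_ceil y
  have := Nat.floor_le_ceil z
  have := Nat.ceil_le_floor_add_one y
  have := Nat.ceil_le_floor_add_one z
  simp only [RegionEq, frac_eq_zero_iff_ceil_le_floor]
  omega

namespace RegionEq

theorem refl (y : ℝ≥0) : RegionEq y y := ⟨rfl, Iff.rfl⟩

theorem symm (h : RegionEq y z) : RegionEq z y := ⟨h.1.symm, h.2.symm⟩

theorem trans (h : RegionEq x y) (h' : RegionEq y z) : RegionEq x z :=
  ⟨h.1.trans h'.1, h.2.trans h'.2⟩

theorem floor_eq (h : RegionEq y z) : ⌊y⌋₊ = ⌊z⌋₊ := h.1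

theorem ceil_eq (h : RegionEq y z) : ⌈y⌉₊ = ⌈z⌉₊ := (regionEq_iff_floor_ceil.1 h).2

theorem le_natCast_iff (h : RegionEq y z) (k : ℕ) : y ≤ k ↔ z ≤ k := by
  rw [← Nat.ceil_le, ← Nat.ceil_le, h.ceil_eq]

theorem lt_natCast_iff (h : RegionEq y z) (k : ℕ) : y < k ↔ z < k := by
  rw [← Nat.floor_lt zero_le, ← Nat.floor_lt zero_le, h.floor_eq]

theorem natCast_lt_iff (h : RegionEq y z) (k : ℕ) : (k : ℝ≥0) < y ↔ (k : ℝ≥0) < z := by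
  rw [← not_le, ← not_le, h.le_natCast_iff]

theorem eq_zero_iff (h : RegionEq y z) : y = 0 ↔ z = 0 := by
  simpa using h.le_natCast_iff 0

theorem add_natCast (h : RegionEq y z) (n : ℕ) : RegionEq (y + n) (z + n) := by
  rw [regionEq_iff_floor_ceil] at h ⊢
  simp only [Nat.floor_add_natCast zero_le, Nat.ceil_add_natCast zero_le, h, and_self]

end RegionEq

theorem regionEq_natCast_iff : RegionEq n z ↔ z = n := by
  refine ⟨fun h => le_antisymm ?_ ?_, fun h => h ▸ RegionEq.refl _⟩
  · exact (h.le_natCast_iff n).1 le_rfl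
  · exact not_lt.1 (mt (h.lt_natCast_iff n).2 (lt_irrefl _))

theorem regionEq_iff_of_frac_ne_zero (h : frac t ≠ 0) :
    RegionEq t x ↔ (⌊t⌋₊ : ℝ≥0) < x ∧ x < ⌊t⌋₊ + 1 := by
  rw [regionEq_iff_floor_ceil, ← Nat.lt_ceil, ← Nat.cast_add_one, ← Nat.floor_lt zero_le,
    ceil_eq_floor_add_one_of_frac_ne_zero h]
  have := Nat.ceil_le_floor_add_one x
  omega

end Regions

section RegionsUpTo

variable {K : ℕ∞} {k c : ℕ} {x y z : ℝ≥0} {S : Set ℝ≥0}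

theorem RegionEq.regionEqK (h : RegionEq y z) : RegionEqK K y z := Or.inl h

theorem regionEqK_natCast_iff :
    RegionEqK (k : ℕ∞) y z ↔ RegionEq y z ∨ ((k : ℝ≥0) < y ∧ (k : ℝ≥0) < z) := by
  simp only [RegionEqK, Nat.cast_inj, exists_eq_left']

theorem RegionEqK.symm (h : RegionEqK K y z) : RegionEqK K z y :=
  h.imp RegionEq.symm fun ⟨k, hk, hky, hkz⟩ => ⟨k, hk, hkz, hky⟩

theorem RegionEqK.trans (h : RegionEqK K x y) (h' : RegionEqK K y z) : RegionEqK K x z := by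
  rcases h with h | ⟨k, rfl, hx, hy⟩
  · exact h'.imp h.trans fun ⟨k, hk, hy, hz⟩ => ⟨k, hk, (h.natCast_lt_iff k).2 hy, hz⟩
  · refine Or.inr ⟨k, rfl, hx, ?_⟩
    exact (regionEqK_natCast_iff.1 h').elim (fun h' => (h'.natCast_lt_iff k).1 hy) And.right

theorem RegionEqK.eq_zero_iff (h : RegionEqK K y z) : y = 0 ↔ z = 0 := by
  rcases h with h | ⟨k, -, hy, hz⟩
  · exact h.eq_zero_iff
  · exact iff_of_false (zero_le.trans_lt hy).ne' (zero_le.trans_lt hz).ne'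

theorem RegionEqK.add_natCast (h : RegionEqK K y z) (n : ℕ) : RegionEqK K (y + n) (z + n) :=
  h.imp (fun h => h.add_natCast n) fun ⟨k, hk, hy, hz⟩ =>
    ⟨k, hk, hy.trans_le le_self_add, hz.trans_le le_self_add⟩

theorem RegionEqK.natCast_lt_iff (h : RegionEqK (k : ℕ∞) y z) (hc : c ≤ k) :
    (c : ℝ≥0) < y ↔ (c : ℝ≥0) < z := by
  have hc' : (c : ℝ≥0) ≤ k := by exact_mod_cast hc
  rcases regionEqK_natCast_iff.1 h with h | ⟨hy, hz⟩
  · exact h.natCast_lt_iff c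
  · exact iff_of_true (hc'.trans_lt hy) (hc'.trans_lt hz)

theorem RegionEqK.lt_natCast_iff (h : RegionEqK (k : ℕ∞) y z) (hc : c ≤ k) :
    y < (c : ℝ≥0) ↔ z < (c : ℝ≥0) := by
  have hc' : (c : ℝ≥0) ≤ k := by exact_mod_cast hc
  rcases regionEqK_natCast_iff.1 h with h | ⟨hy, hz⟩
  · exact h.lt_natCast_iff c
  · exact iff_of_false (hc'.trans_lt hy).not_gt (hc'.trans_lt hz).not_gt

theorem regionEqK_iff_regionEq (hy : y ≤ k) : RegionEqK (k : ℕ∞) y z ↔ RegionEq y z :=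
  regionEqK_natCast_iff.trans (or_iff_left fun h => hy.not_gt h.1)

theorem regionEqK_iff_lt (hy : (k : ℝ≥0) < y) : RegionEqK (k : ℕ∞) y z ↔ (k : ℝ≥0) < z :=
  ⟨fun h => (h.natCast_lt_iff le_rfl).1 hy, fun hz => regionEqK_natCast_iff.2 (Or.inr ⟨hy, hz⟩)⟩

theorem IsRegion.eq_setOf_of_mem (hS : IsRegion k S) (hy : y ∈ S) :
    S = {z | RegionEqK (k : ℕ∞) y z} := by
  obtain ⟨x, rfl⟩ := hS
  exact Set.ext fun z => ⟨hy.symm.trans, hy.trans⟩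

theorem IsRegion.eq_singleton_of_natCast_mem (hS : IsRegion k S) (hc : (c : ℝ≥0) ∈ S)
    (hck : c ≤ k) : S = {(c : ℝ≥0)} := by
  rw [hS.eq_setOf_of_mem hc]
  ext z
  exact (regionEqK_iff_regionEq (by exact_mod_cast hck)).trans regionEq_natCast_iff

end RegionsUpTo

/-! ### Clock constraints -/

section ClockConstraints

variable {K : ℕ} {x y t : ℝ≥0}

theorem ClockConstraint.mem_denote_congr (h : RegionEqK (K : ℕ∞) x y) {φ : ClockConstraint}
    (hφ : φ.maxConst ≤ K) : x ∈ φ.denote ↔ y ∈ φ.denote := by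
  induction φ with
  | gt c => exact h.natCast_lt_iff hφ
  | lt c => exact h.lt_natCast_iff hφ
  | eq c =>
    have hc : c ≤ K := hφ
    simp only [denote, Set.mem_ofPred_eq, le_antisymm_iff, ← not_lt, h.natCast_lt_iff hc,
      h.lt_natCast_iff hc]
  | and φ ψ ihφ ihψ =>
    exact and_congr (ihφ ((le_max_left _ _).trans hφ)) (ihψ ((le_max_right _ _).trans hφ))

theorem mem_regionGuard : x ∈ (regionGuard K t).denote ↔ RegionEqK (K : ℕ∞) t x := by
  unfold regionGuard
  split_ifs with htK ht
  · rw [regionEqK_iff_regionEq htK, eq_floor_of_frac_eq_zero ht, regionEq_natCast_iff,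
      Nat.floor_natCast]
    rfl
  · rw [regionEqK_iff_regionEq htK, regionEq_iff_of_frac_ne_zero ht,
      ceil_eq_floor_add_one_of_frac_ne_zero ht, ← Nat.cast_add_one]
    rfl
  · exact (regionEqK_iff_lt (not_le.1 htK)).symm

theorem self_mem_regionGuard : t ∈ (regionGuard K t).denote :=
  mem_regionGuard.2 (RegionEq.refl t).regionEqK

theorem isRegion_regionGuard : IsRegion K (regionGuard K t).denote :=
  ⟨t, Set.ext fun _ => mem_regionGuard⟩

theorem regionGuard_congr (h : RegionEqK (K : ℕ∞) x y) : regionGuard K x = regionGuard K y := by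
  rcases regionEqK_natCast_iff.1 h with h | ⟨hx, hy⟩
  · simp only [regionGuard, h.le_natCast_iff, h.2, h.floor_eq, h.ceil_eq]
  · simp only [regionGuard, if_neg hx.not_ge, if_neg hy.not_ge]

theorem maxConst_regionGuard_le : (regionGuard K t).maxConst ≤ K := by
  unfold regionGuard
  split_ifs with htK
  · exact Nat.floor_le_of_le htK
  · exact max_le (Nat.floor_le_of_le htK) (Nat.ceil_le.2 htK)
  · exact le_rfl

theorem finite_range_regionGuard (K : ℕ) : (Set.range (regionGuard K)).Finite := by
  let intervals := Set.image2 (fun m n => ClockConstraint.and (.gt m) (.lt n))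
    (Set.Iic K) (Set.Iic K)
  have hfin : (ClockConstraint.eq '' Set.Iic K ∪ intervals ∪ {.gt K}).Finite :=
    (((Set.finite_Iic K).image _).union ((Set.finite_Iic K).image2 _ (Set.finite_Iic K))).union
      (Set.finite_singleton _)
  refine hfin.subset ?_
  rintro _ ⟨t, rfl⟩
  unfold regionGuard
  split_ifs with htK
  · exact Or.inl (Or.inl ⟨_, Nat.floor_le_of_le htK, rfl⟩)
  · exact Or.inl (Or.inr ⟨_, Nat.floor_le_of_le htK, _, Nat.ceil_le.2 htK, rfl⟩)
  · exact Or.inr rfl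

theorem finite_setOf_guard_mem {α Q : Type*} [Finite α] [Finite Q] {G : Set ClockConstraint}
    (hG : G.Finite) : {θ : Transition α Q | θ.guard ∈ G}.Finite := by
  have := hG.to_subtype
  refine (Set.finite_range fun p : Q × Q × α × G × Bool =>
    (⟨p.1, p.2.1, p.2.2.1, p.2.2.2.1, p.2.2.2.2⟩ : Transition α Q)).subset ?_
  intro θ hθ
  exact ⟨(θ.source, θ.target, θ.letter, ⟨θ.guard, hθ⟩, θ.resets), rfl⟩

end ClockConstraints

/-! ### Half-integers -/

section HalfIntegers

variable {x y t : ℝ≥0}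

/-- Half-integral clock values; `IsHalfIntegral` is the corresponding notion for timed words. -/
def IsHalfInteger (x : ℝ≥0) : Prop := ∃ n : ℕ, x = (n : ℝ≥0) / 2

theorem isHalfInteger_natCast_div_two (n : ℕ) : IsHalfInteger ((n : ℝ≥0) / 2) := ⟨n, rfl⟩

theorem isHalfInteger_zero : IsHalfInteger 0 := ⟨0, by simp⟩

theorem IsHalfInteger.add (hx : IsHalfInteger x) (hy : IsHalfInteger y) :
    IsHalfInteger (x + y) := by
  obtain ⟨m, rfl⟩ := hx
  obtain ⟨n, rfl⟩ := hy
  exact ⟨m + n, by push_cast; rw [add_div]⟩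

theorem natCast_two_mul_div_two (k : ℕ) : ((2 * k : ℕ) : ℝ≥0) / 2 = k := by
  push_cast
  field_simp

theorem natCast_lt_natCast_div_two {k n : ℕ} (h : 2 * k < n) : (k : ℝ≥0) < (n : ℝ≥0) / 2 := by
  rw [← natCast_two_mul_div_two k]
  gcongr

theorem hi_eq_floor_add_ceil_div_two (x : ℝ≥0) : hi x = ((⌊x⌋₊ + ⌈x⌉₊ : ℕ) : ℝ≥0) / 2 := by
  unfold hi
  split_ifs with hx
  · rw [eq_floor_of_frac_eq_zero hx, Nat.floor_natCast, Nat.ceil_natCast, ← two_mul,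
      natCast_two_mul_div_two]
  · rw [ceil_eq_floor_add_one_of_frac_ne_zero hx]
    push_cast
    field_simp
    ring

theorem RegionEq.hi_eq (h : RegionEq x y) : hi x = hi y := by
  rw [hi_eq_floor_add_ceil_div_two, hi_eq_floor_add_ceil_div_two, h.floor_eq, h.ceil_eq]

theorem IsHalfInteger.hi_eq (hx : IsHalfInteger x) : hi x = x := by
  obtain ⟨n, rfl⟩ := hx
  have hfloor : ⌊(n : ℝ≥0) / 2⌋₊ = n / 2 := by
    rw [Nat.floor_div_ofNat, Nat.floor_natCast]
  have hceil : ⌈(n : ℝ≥0) / 2⌉₊ = (n + 1) / 2 := by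
    refine eq_of_forall_ge_iff fun k => ?_
    rw [Nat.ceil_le, div_le_iff₀ two_pos]
    norm_cast
    omega
  rw [hi_eq_floor_add_ceil_div_two, hfloor, hceil]
  congr 2
  omega

theorem IsHalfInteger.eq_of_regionEq (hx : IsHalfInteger x) (hy : IsHalfInteger y)
    (h : RegionEq x y) : x = y := by
  rw [← hx.hi_eq, ← hy.hi_eq, h.hi_eq]

theorem IsHalfInteger.eq_natCast_of_add (hx : IsHalfInteger x) (ht : IsHalfInteger t)
    (ht_nat : ∀ n : ℕ, t ≠ n) (hxt_nat : ∀ n : ℕ, x + t ≠ n) : ∃ n : ℕ, x = n := by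
  obtain ⟨i, rfl⟩ := hx
  obtain ⟨j, rfl⟩ := ht
  rw [← add_div, ← Nat.cast_add] at hxt_nat
  obtain ⟨n, rfl | rfl⟩ := Nat.even_or_odd' i
  · exact ⟨n, natCast_two_mul_div_two n⟩
  obtain ⟨k, rfl | rfl⟩ := Nat.even_or_odd' j
  · exact absurd (natCast_two_mul_div_two k) (ht_nat k)
  · refine absurd ?_ (hxt_nat (n + k + 1))
    rw [show 2 * n + 1 + (2 * k + 1) = 2 * (n + k + 1) by ring, natCast_two_mul_div_two]

theorem finite_setOf_isHalfInteger_le (K : ℕ) : {x | IsHalfInteger x ∧ x ≤ K}.Finite := by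
  refine ((Set.finite_Iic (2 * K)).image fun n : ℕ => (n : ℝ≥0) / 2).subset ?_
  rintro _ ⟨⟨n, rfl⟩, hn⟩
  exact ⟨n, not_lt.1 (mt natCast_lt_natCast_div_two hn.not_gt), rfl⟩

end HalfIntegers

/-! ### Runs of deterministic automata -/

namespace TA

variable {α Q : Type*} {A : TA α Q} {c c' d d' : Q × ℝ≥0} {p : ℝ≥0 × α} {w : TimedWord α}
  {e e' : List (Transition α Q)} {θ θ' : Transition α Q}

/-- A single step of a run: the transition `θ` leads from `c` to `d` while `A` reads `p`. -/
structure Move (A : TA α Q) (θ : Transition α Q) (c : Q × ℝ≥0) (p : ℝ≥0 × α)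
    (d : Q × ℝ≥0) : Prop where
  mem : θ ∈ A.trans
  source : θ.source = c.1
  letter : θ.letter = p.2
  guard : c.2 + p.1 ∈ θ.guard.denote
  target : d = (θ.target, if θ.resets = true then 0 else c.2 + p.1)

theorem isRun_nil_iff : A.IsRun c [] e d ↔ e = [] ∧ d = c := by
  constructor
  · rintro ⟨⟩
    exact ⟨rfl, rfl⟩
  · rintro ⟨rfl, rfl⟩
    exact .nil _

theorem isRun_cons_iff : A.IsRun c (p :: w) e d ↔
    ∃ θ c' e', A.Move θ c p c' ∧ A.IsRun c' w e' d ∧ e = θ :: e' := by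
  constructor
  · rintro (_ | ⟨θ, ν, t, _, e, _, hθ, hg, hr⟩)
    exact ⟨θ, _, e, ⟨hθ, rfl, rfl, hg, rfl⟩, hr, rfl⟩
  · obtain ⟨q, y⟩ := c
    obtain ⟨t, a⟩ := p
    rintro ⟨θ, _, e', ⟨hθ, rfl, rfl, hg, rfl⟩, hr, rfl⟩
    exact .cons θ y t w e' d hθ hg hr

theorem Move.isRun (h : A.Move θ c p d) : A.IsRun c [p] [θ] d :=
  isRun_cons_iff.2 ⟨θ, d, [], h, .nil d, rfl⟩

theorem IsRun.snoc (h : A.IsRun c w e c') (hθ : A.Move θ c' p d) :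
    A.IsRun c (w ++ [p]) (e ++ [θ]) d := by
  induction h with
  | nil _ => exact hθ.isRun
  | cons θ' ν t w e _ hθ' hg _ ih => exact .cons θ' ν t _ _ _ hθ' hg (ih hθ)

theorem IsRun.exists_of_snoc (h : A.IsRun c (w ++ [p]) e d) :
    ∃ e' c' θ, A.IsRun c w e' c' ∧ A.Move θ c' p d := by
  induction w generalizing c e with
  | nil =>
    obtain ⟨θ, c', _, hθ, hr, -⟩ := isRun_cons_iff.1 h
    obtain ⟨-, rfl⟩ := isRun_nil_iff.1 hr
    exact ⟨[], c, θ, .nil c, hθ⟩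
  | cons p' w ih =>
    obtain ⟨θ', c', _, hθ', hr, -⟩ := isRun_cons_iff.1 h
    obtain ⟨e', d', θ, hr', hθ⟩ := ih hr
    exact ⟨θ' :: e', d', θ, isRun_cons_iff.2 ⟨θ', c', e', hθ', hr', rfl⟩, hθ⟩

theorem Move.unique (hA : A.Deterministic) (h : A.Move θ c p d) (h' : A.Move θ' c p d') :
    θ = θ' := by
  by_contra hne
  rcases hA θ h.mem θ' h'.mem hne with hs | hl | hg
  · exact hs (h.source.trans h'.source.symm)
  · exact hl (h.letter.trans h'.letter.symm)
  · exact Set.notMem_empty (c.2 + p.1) (hg.subset ⟨h.guard, h'.guard⟩)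

theorem IsRun.unique (hA : A.Deterministic) (h : A.IsRun c w e d) (h' : A.IsRun c w e' d') :
    e = e' ∧ d = d' := by
  induction w generalizing c e e' with
  | nil =>
    obtain ⟨rfl, rfl⟩ := isRun_nil_iff.1 h
    obtain ⟨rfl, rfl⟩ := isRun_nil_iff.1 h'
    exact ⟨rfl, rfl⟩
  | cons p w ih =>
    obtain ⟨θ, c₁, e₁, hθ, hr, rfl⟩ := isRun_cons_iff.1 h
    obtain ⟨θ', c₂, e₂, hθ', hr', rfl⟩ := isRun_cons_iff.1 h'
    obtain rfl := hθ.unique hA hθ'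
    obtain rfl : c₁ = c₂ := hθ.target.trans hθ'.target.symm
    obtain ⟨rfl, rfl⟩ := ih hr hr'
    exact ⟨rfl, rfl⟩

theorem exists_isRun_of_forall_move {f : TimedWord α → Q × ℝ≥0} (hnil : f [] = (A.init, 0))
    (hsnoc : ∀ w p, ∃ θ, A.Move θ (f w) p (f (w ++ [p]))) (w : TimedWord α) :
    ∃ e, A.IsRun (A.init, 0) w e (f w) := by
  induction w using List.reverseRecOn with
  | nil => exact ⟨[], hnil ▸ .nil _⟩
  | append_singleton w p ih =>
    obtain ⟨e, he⟩ := ih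
    obtain ⟨θ, hθ⟩ := hsnoc w p
    exact ⟨e ++ [θ], he.snoc hθ⟩

theorem IsRun.mem_language_iff (hA : A.Deterministic) (h : A.IsRun (A.init, 0) w e c) :
    w ∈ A.language ↔ c.1 ∈ A.final := by
  constructor
  · rintro ⟨e', q, ν, h', hq⟩
    rw [(h.unique hA h').2]
    exact hq
  · exact fun hq => ⟨e, c.1, c.2, h, hq⟩

theorem maxConst_le_of_mem (hA : A.trans.Finite) (hθ : θ ∈ A.trans) :
    θ.guard.maxConst ≤ A.maxConst :=
  le_csSup (hA.image _).bddAbove ⟨θ, hθ, rfl⟩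

end TA

/-! ### Clock machines -/

/-- A complete deterministic one-clock automaton in functional form: in state `s`, on the letter
`a` and at clock value `x`, it goes to the state `(step s a x).1` and resets the clock iff
`(step s a x).2` is `true`. The state space need not be finite. -/
structure ClockMachine (α S : Type*) where
  step : S → α → ℝ≥0 → S × Bool
  final : Set S
  bound : ℕ
  step_congr : ∀ s a x y, RegionEqK (bound : ℕ∞) x y → step s a x = step s a y

namespace ClockMachine

variable {α S : Type*} (M : ClockMachine α S)

/-- The configuration that follows `c` when the machine reads `p`. -/
def next (c : S × ℝ≥0) (p : ℝ≥0 × α) : S × ℝ≥0 :=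
  let m := M.step c.1 p.2 (c.2 + p.1)
  (m.1, if m.2 = true then 0 else c.2 + p.1)

/-- The configuration that the machine reaches from `c` on a timed word. -/
def run (c : S × ℝ≥0) (w : TimedWord α) : S × ℝ≥0 := w.foldl M.next c

/-- The language that the machine accepts from the configuration `c`. -/
def lang (c : S × ℝ≥0) : Set (TimedWord α) := {w | (M.run c w).1 ∈ M.final}

variable {M} in
theorem mem_lang {c : S × ℝ≥0} {w : TimedWord α} : w ∈ M.lang c ↔ (M.run c w).1 ∈ M.final :=
  Iff.rfl

theorem run_cons (c : S × ℝ≥0) (p : ℝ≥0 × α) (w : TimedWord α) :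
    M.run c (p :: w) = M.run (M.next c p) w := rfl

theorem run_append (c : S × ℝ≥0) (u w : TimedWord α) :
    M.run c (u ++ w) = M.run (M.run c u) w := List.foldl_append

theorem run_snoc (c : S × ℝ≥0) (u : TimedWord α) (p : ℝ≥0 × α) :
    M.run c (u ++ [p]) = M.next (M.run c u) p := M.run_append c u [p]

theorem residual_lang (c : S × ℝ≥0) (u : TimedWord α) :
    residual u (M.lang c) = M.lang (M.run c u) :=
  Set.ext fun w => by rw [residual, Set.mem_ofPred_eq, mem_lang, mem_lang, run_append]

theorem run_fst_eq_of_bound_lt (s : S) {y y' : ℝ≥0} (hy : (M.bound : ℝ≥0) < y)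
    (hy' : (M.bound : ℝ≥0) < y') (w : TimedWord α) :
    (M.run (s, y) w).1 = (M.run (s, y') w).1 := by
  induction w generalizing s y y' with
  | nil => rfl
  | cons p w ih =>
    have hyp : (M.bound : ℝ≥0) < y + p.1 := hy.trans_le le_self_add
    have hyp' : (M.bound : ℝ≥0) < y' + p.1 := hy'.trans_le le_self_add
    have hstep := M.step_congr s p.2 _ _ ((regionEqK_iff_lt hyp).2 hyp')
    simp only [run_cons, next, hstep]
    split_ifs
    · rfl
    · exact ih _ hyp hyp'

theorem lang_eq_of_bound_lt (s : S) {y y' : ℝ≥0} (hy : (M.bound : ℝ≥0) < y)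
    (hy' : (M.bound : ℝ≥0) < y') : M.lang (s, y) = M.lang (s, y') :=
  Set.ext fun w => by rw [mem_lang, mem_lang, M.run_fst_eq_of_bound_lt s hy hy' w]

/-- The machine that behaves like `M` with a clock that is `n` ahead, until the first reset. The
Boolean component of the state records whether a reset has happened. -/
def shift (n : ℕ) : ClockMachine α (S × Bool) where
  step s a x :=
    let m := M.step s.1 a (if s.2 = true then x else x + n)
    ((m.1, s.2 || m.2), m.2)
  final := {s | s.1 ∈ M.final}
  bound := M.bound
  step_congr s a x y h := by
    rcases s with ⟨s, _ | _⟩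
    · simp only [Bool.false_eq_true, if_false, M.step_congr s a _ _ (h.add_natCast n)]
    · simp only [if_true, M.step_congr s a _ _ h]

theorem run_shift (n : ℕ) (s : S) (b : Bool) (y : ℝ≥0) (w : TimedWord α) :
    ((M.shift n).run ((s, b), y) w).1.1 =
      (M.run (s, if b = true then y else y + n) w).1 := by
  induction w generalizing s b y with
  | nil => rfl
  | cons p w ih =>
    have hclock : (if b = true then y + p.1 else y + p.1 + n) =
        (if b = true then y else y + n) + p.1 := by
      split_ifs
      · rfl
      · ring
    simp only [run_cons, next, shift, hclock] at ih ⊢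
    rw [ih]
    congr 3
    cases b <;> cases (M.step s p.2 _).2 <;> simp [add_right_comm]

theorem lang_shift (n : ℕ) (s : S) : (M.shift n).lang ((s, false), 0) = M.lang (s, n) := by
  ext w
  have hrun := M.run_shift n s false 0 w
  rw [if_neg Bool.false_ne_true, zero_add] at hrun
  rw [mem_lang, mem_lang, ← hrun]
  rfl

end ClockMachine

/-! ### Two-clock regions -/

/-- `RegionEq` for real numbers of arbitrary sign, such as differences of clock values. -/
def SameCell (x y : ℝ) : Prop := ⌊x⌋ = ⌊y⌋ ∧ ⌈x⌉ = ⌈y⌉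

namespace SameCell

variable {x y : ℝ}

theorem symm (h : SameCell x y) : SameCell y x := ⟨h.1.symm, h.2.symm⟩

theorem neg (h : SameCell x y) : SameCell (-x) (-y) := by
  simp only [SameCell, Int.floor_neg, Int.ceil_neg, h.1, h.2, and_self]

theorem add_natCast (h : SameCell x y) (n : ℕ) : SameCell (x + n) (y + n) := by
  simp only [SameCell, Int.floor_add_natCast, Int.ceil_add_natCast, h.1, h.2, and_self]

theorem lt_intCast (h : SameCell x y) {k : ℤ} (hx : x < k) : y < k := by
  rw [← Int.floor_lt] at hx ⊢
  exact h.1 ▸ hx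

end SameCell

theorem regionEq_iff_sameCell {y z : ℝ≥0} : RegionEq y z ↔ SameCell y z := by
  have hfloor (x : ℝ≥0) : ⌊(x : ℝ)⌋ = ⌊x⌋₊ := by
    rw [← Int.natCast_floor_eq_floor x.coe_nonneg]
    exact congrArg _ (Nonneg.nat_floor_coe x)
  have hceil (x : ℝ≥0) : ⌈(x : ℝ)⌉ = ⌈x⌉₊ := by
    rw [← Int.natCast_ceil_eq_ceil x.coe_nonneg]
    exact congrArg _ (Nonneg.nat_ceil_coe x)
  simp only [regionEq_iff_floor_ceil, SameCell, hfloor, hceil, Nat.cast_inj]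

theorem exists_forall_regionEq_iff_of_frac_ne_zero {x : ℝ≥0} (h : frac x ≠ 0) :
    ∃ k : ℤ, ∀ y : ℝ≥0, RegionEq x y ↔ (k : ℝ) < (y : ℝ) ∧ (y : ℝ) < (k : ℝ) + 1 :=
  ⟨⌊x⌋₊, fun _ => (regionEq_iff_of_frac_ne_zero h).trans (by norm_cast)⟩

/-- The region equivalence of Alur and Dill, without a maximum constant, for the values `(y, z)`
and `(y', z')` of two clocks. -/
structure PairRegionEq (y z y' z' : ℝ≥0) : Prop where
  left : RegionEq y y'
  right : RegionEq z z'
  diff : SameCell ((y : ℝ) - z) ((y' : ℝ) - z')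

namespace PairRegionEq

variable {y z y' z' t t' : ℝ≥0}

theorem symm (h : PairRegionEq y z y' z') : PairRegionEq y' z' y z :=
  ⟨h.left.symm, h.right.symm, h.diff.symm⟩

theorem swap (h : PairRegionEq y z y' z') : PairRegionEq z y z' y' :=
  ⟨h.right, h.left, by simpa only [neg_sub] using h.diff.neg⟩

theorem of_regionEq (h : RegionEq y y') : PairRegionEq y 0 y' 0 :=
  ⟨h, RegionEq.refl 0, by simpa only [NNReal.coe_zero, sub_zero] using regionEq_iff_sameCell.1 h⟩

theorem ite_zero (h : PairRegionEq y z y' z') (b b' : Bool) :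
    PairRegionEq (if b = true then 0 else y) (if b' = true then 0 else z)
      (if b = true then 0 else y') (if b' = true then 0 else z') := by
  cases b <;> cases b'
  · exact h
  · exact of_regionEq h.left
  · exact (of_regionEq h.right).swap
  · exact of_regionEq (RegionEq.refl 0)

theorem add (h : PairRegionEq y z y' z') (hy : RegionEq (y + t) (y' + t'))
    (hz : RegionEq (z + t) (z' + t')) : PairRegionEq (y + t) (z + t) (y' + t') (z' + t') :=
  ⟨hy, hz, by simpa only [NNReal.coe_add, add_sub_add_right_eq_sub] using h.diff⟩

theorem exists_delay_of_eq_natCast (h : PairRegionEq y z y' z') {k : ℕ} (hk : y + t = k) :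
    ∃ t', PairRegionEq (y + t) (z + t) (y' + t') (z' + t') := by
  have hle : y' ≤ k := (h.left.le_natCast_iff k).1 (hk ▸ le_self_add)
  have hy' : y' + (k - y') = k := add_tsub_cancel_of_le hle
  refine ⟨k - y', h.add (by rw [hy', hk]; exact RegionEq.refl _) ?_⟩
  rw [regionEq_iff_sameCell]
  convert h.swap.diff.add_natCast k using 1
  · rw [← NNReal.coe_natCast k, ← hk]
    push_cast
    ring
  · push_cast [NNReal.coe_sub hle]
    ring

-- The open unit intervals `(k - y', k + 1 - y')` and `(l - z', l + 1 - z')` meet, and the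
-- intersection contains positive numbers.
theorem exists_delay_of_frac_ne_zero (h : PairRegionEq y z y' z') (hy : frac (y + t) ≠ 0)
    (hz : frac (z + t) ≠ 0) : ∃ t', PairRegionEq (y + t) (z + t) (y' + t') (z' + t') := by
  obtain ⟨k, hk⟩ := exists_forall_regionEq_iff_of_frac_ne_zero hy
  obtain ⟨l, hl⟩ := exists_forall_regionEq_iff_of_frac_ne_zero hz
  obtain ⟨hky, hyk⟩ := (hk _).1 (RegionEq.refl _)
  obtain ⟨hlz, hzl⟩ := (hl _).1 (RegionEq.refl _)
  push_cast at hky hyk hlz hzl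
  have hy' : (y' : ℝ) < (k + 1 : ℤ) :=
    (regionEq_iff_sameCell.1 h.left).lt_intCast (by push_cast; linarith [t.coe_nonneg])
  have hz' : (z' : ℝ) < (l + 1 : ℤ) :=
    (regionEq_iff_sameCell.1 h.right).lt_intCast (by push_cast; linarith [t.coe_nonneg])
  have hyz' : (y' : ℝ) - z' < (k - l + 1 : ℤ) := h.diff.lt_intCast (by push_cast; linarith)
  have hzy' : (z' : ℝ) - y' < (l - k + 1 : ℤ) := h.swap.diff.lt_intCast (by push_cast; linarith)
  push_cast at hy' hz' hyz' hzy'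
  obtain ⟨s, hs, hs'⟩ : ∃ s : ℝ, max 0 (max (k - y' : ℝ) (l - z')) < s ∧
      s < min (k + 1 - y' : ℝ) (l + 1 - z') := by
    refine exists_between ?_
    simp only [lt_min_iff, max_lt_iff]
    refine ⟨⟨?_, ?_, ?_⟩, ?_, ?_, ?_⟩ <;> linarith
  simp only [lt_min_iff, max_lt_iff] at hs hs'
  lift s to ℝ≥0 using hs.1.le
  refine ⟨s, h.add ((hk _).2 ⟨?_, ?_⟩) ((hl _).2 ⟨?_, ?_⟩)⟩ <;> push_cast <;> linarith

theorem exists_delay (h : PairRegionEq y z y' z') (t : ℝ≥0) :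
    ∃ t', PairRegionEq (y + t) (z + t) (y' + t') (z' + t') := by
  by_cases hy : frac (y + t) = 0
  · exact h.exists_delay_of_eq_natCast (eq_floor_of_frac_eq_zero hy)
  by_cases hz : frac (z + t) = 0
  · obtain ⟨t', ht'⟩ := h.swap.exists_delay_of_eq_natCast (eq_floor_of_frac_eq_zero hz)
    exact ⟨t', ht'.swap⟩
  exact h.exists_delay_of_frac_ne_zero hy hz

end PairRegionEq

namespace ClockMachine

variable {α S S' : Type*} (M : ClockMachine α S) (M' : ClockMachine α S') {y z y' z' t t' : ℝ≥0}

theorem exists_next_eq_of_regionEq (s : S) (a : α) (h : RegionEq (y + t) (y' + t')) :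
    ∃ (r : S) (b : Bool), M.next (s, y) (t, a) = (r, if b = true then 0 else y + t) ∧
      M.next (s, y') (t', a) = (r, if b = true then 0 else y' + t') := by
  refine ⟨_, _, rfl, ?_⟩
  simp only [next, M.step_congr s a _ _ h.regionEqK]

theorem exists_run_fst_eq (h : PairRegionEq y z y' z') (s : S) (r : S') (w : TimedWord α) :
    ∃ w', (M.run (s, y') w').1 = (M.run (s, y) w).1 ∧
      (M'.run (r, z') w').1 = (M'.run (r, z) w).1 := by
  induction w generalizing y z y' z' s r with
  | nil => exact ⟨[], rfl, rfl⟩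
  | cons p w ih =>
    obtain ⟨t, a⟩ := p
    obtain ⟨t', ht'⟩ := h.exists_delay t
    obtain ⟨s₁, b, hs, hs'⟩ := M.exists_next_eq_of_regionEq s a ht'.left
    obtain ⟨r₁, b', hr, hr'⟩ := M'.exists_next_eq_of_regionEq r a ht'.right
    obtain ⟨w', hw, hw'⟩ := ih (ht'.ite_zero b b') s₁ r₁
    exact ⟨(t', a) :: w', by rw [run_cons, run_cons, hs, hs', hw],
      by rw [run_cons, run_cons, hr, hr', hw']⟩

theorem lang_eq_of_pairRegionEq (h : PairRegionEq y z y' z') {s : S} {r : S'}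
    (heq : M.lang (s, y) = M'.lang (r, z)) : M.lang (s, y') = M'.lang (r, z') := by
  ext w
  obtain ⟨w', hw, hw'⟩ := M.exists_run_fst_eq M' h.symm s r w
  rw [mem_lang, mem_lang, ← hw, ← hw', ← mem_lang, ← mem_lang, heq]

end ClockMachine

/-! ### Recognizability by clock machines -/

namespace TA

variable {α Q : Type*} {A : TA α Q} {c d : Q × ℝ≥0} {p : ℝ≥0 × α} {w : TimedWord α}
  {e : List (Transition α Q)} {θ : Transition α Q} {q q' : Q} {y : ℝ≥0}

/-- The transitions of `A` that are enabled in the state `s` on the letter `a` at clock value `x`,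
where the state `none` is a sink without transitions. -/
def enabled (A : TA α Q) (s : Option Q) (a : α) (x : ℝ≥0) : Set (Transition α Q) :=
  {θ | θ ∈ A.trans ∧ some θ.source = s ∧ θ.letter = a ∧ x ∈ θ.guard.denote}

open Classical in
/-- The target and the reset bit of some transition in `E`; if `E` is empty, the move to the sink
`none`. -/
noncomputable def outcome (E : Set (Transition α Q)) : Option Q × Bool :=
  if h : E.Nonempty then (some h.some.target, h.some.resets) else (none, true)

/-- The clock machine of a 1-DTA, completed by the sink `none`. -/
noncomputable def IsDTA.machine (hA : A.IsDTA) : ClockMachine α (Option Q) where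
  step s a x := outcome (A.enabled s a x)
  final := some '' A.final
  bound := A.maxConst
  step_congr s a x y h := by
    congr 1
    ext θ
    refine and_congr_right fun hθ => and_congr_right fun _ => and_congr_right fun _ => ?_
    exact ClockConstraint.mem_denote_congr h (maxConst_le_of_mem hA.finite_trans hθ)

variable (hA : A.IsDTA)
include hA

theorem Move.machine_next (h : A.Move θ c p d) :
    hA.machine.next (some c.1, c.2) p = (some d.1, d.2) := by
  have hθ : θ ∈ A.enabled (some c.1) p.2 (c.2 + p.1) :=
    ⟨h.mem, congrArg some h.source, h.letter, h.guard⟩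
  have hne : (A.enabled (some c.1) p.2 (c.2 + p.1)).Nonempty := ⟨θ, hθ⟩
  obtain ⟨hmem, hsource, hletter, hguard⟩ := hne.some_mem
  have hsome : hne.some = θ :=
    Move.unique hA.deterministic ⟨hmem, Option.some.inj hsource, hletter, hguard, rfl⟩ h
  simp only [ClockMachine.next, IsDTA.machine, outcome, dif_pos hne, hsome, h.target]

theorem IsRun.machine_run (h : A.IsRun c w e d) :
    hA.machine.run (some c.1, c.2) w = (some d.1, d.2) := by
  induction w generalizing c e with
  | nil =>
    obtain ⟨-, rfl⟩ := isRun_nil_iff.1 h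
    rfl
  | cons p w ih =>
    obtain ⟨θ, c', e', hθ, hr, -⟩ := isRun_cons_iff.1 h
    rw [ClockMachine.run_cons, hθ.machine_next hA, ih hr]

theorem machine_next_fst_of_enabled_eq_empty {s : Option Q}
    (h : A.enabled s p.2 (y + p.1) = ∅) : (hA.machine.next (s, y) p).1 = none := by
  simp only [ClockMachine.next, IsDTA.machine, outcome, h, Set.not_nonempty_empty, dite_false]

theorem machine_run_fst_of_eq_none {s : Option Q × ℝ≥0} (hs : s.1 = none) (w : TimedWord α) :
    (hA.machine.run s w).1 = none := by
  obtain ⟨_, y⟩ := s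
  obtain rfl := hs
  induction w generalizing y with
  | nil => rfl
  | cons p w ih =>
    have hnext : (hA.machine.next (none, y) p).1 = none :=
      machine_next_fst_of_enabled_eq_empty hA <|
        Set.eq_empty_of_forall_notMem fun θ hθ => Option.some_ne_none _ hθ.2.1
    rw [ClockMachine.run_cons, ← Prod.mk.eta (p := hA.machine.next (none, y) p), hnext]
    exact ih _

theorem exists_isRun_of_machine_run (h : (hA.machine.run (some q, y) w).1 = some q') :
    ∃ e y', A.IsRun (q, y) w e (q', y') := by
  induction w generalizing q y with
  | nil =>
    cases h
    exact ⟨[], y, .nil _⟩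
  | cons p w ih =>
    rw [ClockMachine.run_cons] at h
    rcases Set.eq_empty_or_nonempty (A.enabled (some q) p.2 (y + p.1)) with
      hempty | ⟨θ, hmem, hsource, hletter, hguard⟩
    · have hnext := machine_next_fst_of_enabled_eq_empty hA hempty
      exact absurd (h.symm.trans (machine_run_fst_of_eq_none hA hnext w)) (Option.some_ne_none _)
    · have hθ : A.Move θ (q, y) p _ := ⟨hmem, Option.some.inj hsource, hletter, hguard, rfl⟩
      rw [hθ.machine_next hA] at h
      obtain ⟨e, y', hr⟩ := ih h
      exact ⟨θ :: e, y', isRun_cons_iff.2 ⟨θ, _, e, hθ, hr, rfl⟩⟩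

theorem lang_machine : hA.machine.lang (some A.init, 0) = A.language := by
  ext w
  constructor
  · rintro ⟨q, hq, h⟩
    obtain ⟨e, y, hr⟩ := exists_isRun_of_machine_run hA h.symm
    exact ⟨e, q, y, hr, hq⟩
  · rintro ⟨e, q, y, hr, hq⟩
    exact ⟨q, hq, by rw [hr.machine_run hA]⟩

theorem IsRun.residual_language (h : A.IsRun (A.init, 0) w e c) :
    residual w A.language = hA.machine.lang (some c.1, c.2) := by
  rw [← lang_machine hA, ClockMachine.residual_lang, h.machine_run hA]

end TA

namespace ClockMachine

variable {α S Q : Type*} (M : ClockMachine α S) (e : S ≃ Q) (s : S)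

/-- The automaton of a clock machine, whose guards are the regions up to the bound of the machine.
Its states are renamed along `e`, as `Recognizable` asks for states in the lowest universe. -/
noncomputable def automaton : TA α Q where
  init := e s
  trans := {θ | ∃ x, θ.guard = regionGuard M.bound x ∧
    M.step (e.symm θ.source) θ.letter x = (e.symm θ.target, θ.resets)}
  final := e '' M.final

theorem deterministic_automaton : (M.automaton e s).Deterministic := by
  rintro ⟨p, q, a, _, b⟩ ⟨x, rfl, hx⟩ ⟨p', q', a', _, b'⟩ ⟨x', rfl, hx'⟩ hne
  by_contra! hcon
  obtain ⟨hp, ha, z, hz, hz'⟩ := hcon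
  obtain rfl : p = p' := hp
  obtain rfl : a = a' := ha
  have hxx' : RegionEqK (M.bound : ℕ∞) x x' :=
    (mem_regionGuard.1 hz).trans (mem_regionGuard.1 hz').symm
  have hstep := hx.symm.trans ((M.step_congr _ _ _ _ hxx').trans hx')
  obtain rfl : q = q' := e.symm.injective (Prod.ext_iff.1 hstep).1
  obtain rfl : b = b' := (Prod.ext_iff.1 hstep).2
  exact hne (by rw [regionGuard_congr hxx'])

theorem isDTA_automaton [Finite α] [Finite Q] : (M.automaton e s).IsDTA where
  finite_states := inferInstance
  finite_trans := (finite_setOf_guard_mem (finite_range_regionGuard M.bound)).subset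
    fun _ ⟨x, hx, _⟩ => ⟨x, hx.symm⟩
  deterministic := M.deterministic_automaton e s

theorem exists_isRun_automaton (w : TimedWord α) : ∃ r, (M.automaton e s).IsRun
    ((M.automaton e s).init, 0) w r (e (M.run (s, 0) w).1, (M.run (s, 0) w).2) := by
  refine TA.exists_isRun_of_forall_move
    (f := fun w => (e (M.run (s, 0) w).1, (M.run (s, 0) w).2)) rfl (fun w p => ?_) w
  let c := M.run (s, 0) w
  let m := M.step c.1 p.2 (c.2 + p.1)
  refine ⟨⟨e c.1, e m.1, p.2, regionGuard M.bound (c.2 + p.1), m.2⟩,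
    ⟨c.2 + p.1, rfl, ?_⟩, rfl, rfl, self_mem_regionGuard, ?_⟩
  · simp only [Equiv.symm_apply_apply]
    rfl
  · simp only [run_snoc]
    rfl

theorem language_automaton : (M.automaton e s).language = M.lang (s, 0) := by
  ext w
  obtain ⟨r, hr⟩ := M.exists_isRun_automaton e s w
  rw [hr.mem_language_iff (M.deterministic_automaton e s)]
  exact e.injective.mem_set_image

theorem recognizable_lang_zero [Finite α] [Finite S] : Recognizable (M.lang (s, 0)) :=
  ⟨_, M.automaton (Finite.equivFin S) s, M.isDTA_automaton _ s, M.language_automaton _ s⟩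

theorem recognizable_lang_natCast [Finite α] [Finite S] (n : ℕ) : Recognizable (M.lang (s, n)) :=
  M.lang_shift n s ▸ (M.shift n).recognizable_lang_zero (s, false)

theorem recognizable_lang_of_bound_lt [Finite α] [Finite S] {y : ℝ≥0}
    (hy : (M.bound : ℝ≥0) < y) : Recognizable (M.lang (s, y)) := by
  have hbound : (M.bound : ℝ≥0) < (M.bound + 1 : ℕ) := by exact_mod_cast Nat.lt_succ_self _
  rw [M.lang_eq_of_bound_lt s hy hbound]
  exact M.recognizable_lang_natCast s _

end ClockMachine

theorem TA.IsDTA.recognizable_language {α Q : Type*} [Finite α] {A : TA α Q} (hA : A.IsDTA) :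
    Recognizable A.language := by
  have := hA.finite_states
  rw [← TA.lang_machine hA]
  exact hA.machine.recognizable_lang_zero _

theorem Recognizable.exists_machine {α : Type*} {L : Set (TimedWord α)} (h : Recognizable L) :
    ∃ (S : Type) (_ : Finite S) (M : ClockMachine α S) (s : S), M.lang (s, 0) = L := by
  obtain ⟨Q, A, hA, rfl⟩ := h
  have := hA.finite_states
  exact ⟨Option Q, inferInstance, hA.machine, some A.init, TA.lang_machine hA⟩

-- The residual is recognized by a machine `M'` started at `0`, so that the two-clock region of
-- `(y, 0)` decides it, and this is determined by the region of `y`.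
theorem ClockMachine.lang_eq_of_recognizable {α S : Type*} (M : ClockMachine α S) {s : S}
    {y y' : ℝ≥0} (h : Recognizable (M.lang (s, y))) (hy : RegionEq y y') :
    M.lang (s, y') = M.lang (s, y) := by
  obtain ⟨S', _, M', r, hr⟩ := h.exists_machine
  rw [← hr]
  exact M.lang_eq_of_pairRegionEq M' (.of_regionEq hy) hr.symm

/-! ### Half-integral words -/

section HalfIntegralWords

variable {α : Type*} {R : TimedWord α → ℝ≥0}

theorem HIWord.induction {p : HIWord α → Prop} (nil : p HIWord.nil)
    (snoc : ∀ (u : HIWord α) (n : ℕ) (a : α), p u → p (u.snoc n a)) (u : HIWord α) : p u := by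
  obtain ⟨w, hw⟩ := u
  induction w using List.reverseRecOn with
  | nil => exact nil
  | append_singleton w x ih =>
    obtain ⟨t, a⟩ := x
    obtain ⟨n, rfl⟩ : IsHalfInteger t := hw (t, a) (by simp)
    exact snoc ⟨w, fun x hx => hw x (by simp [hx])⟩ n a (ih _)

theorem HIWord.coe_snoc (u : HIWord α) (n : ℕ) (a : α) :
    (u.snoc n a).1 = u.1 ++ [((n : ℝ≥0) / 2, a)] := rfl

theorem IsResetFunction.isHalfInteger (hR : IsResetFunction R) (u : HIWord α) :
    IsHalfInteger (R u.1) := by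
  induction u using HIWord.induction with
  | nil => exact hR.1.symm ▸ isHalfInteger_zero
  | snoc u n a ih =>
    rw [HIWord.coe_snoc]
    rcases hR.2 u.1 ((n : ℝ≥0) / 2) a with h | h <;> rw [h]
    · exact isHalfInteger_zero
    · exact ih.add (isHalfInteger_natCast_div_two n)

theorem ClockMachine.isResetFunction_run {S : Type*} (M : ClockMachine α S) (s : S) :
    IsResetFunction fun w => (M.run (s, 0) w).2 := by
  refine ⟨rfl, fun u t a => ?_⟩
  simp only [run_snoc, next]
  split_ifs
  · exact Or.inl rfl
  · exact Or.inr rfl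

theorem TA.IsRun.isHalfInteger {Q : Type*} {A : TA α Q} (hA : A.IsDTA) {u : HIWord α}
    {e : List (Transition α Q)} {c : Q × ℝ≥0} (h : A.IsRun (A.init, 0) u.1 e c) :
    IsHalfInteger c.2 := by
  simpa only [h.machine_run hA] using (hA.machine.isResetFunction_run (some A.init)).isHalfInteger u

theorem isHalfIntegral_normalForm (R : TimedWord α → ℝ≥0) (w : TimedWord α) :
    IsHalfIntegral (normalForm R w) := by
  induction w using List.reverseRecOn with
  | nil => exact HIWord.nil.2
  | append_singleton w x ih =>
    intro p hp
    rw [normalForm_snoc, List.mem_append, List.mem_singleton] at hp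
    rcases hp with hp | rfl
    · exact ih p hp
    · exact (normalForm_delay_spec _ _).1

/-- The normal form `N^R(w)` as an element of the subtype of half-integral words. -/
noncomputable def normalWord (R : TimedWord α → ℝ≥0) (w : TimedWord α) : HIWord α :=
  ⟨normalForm R w, isHalfIntegral_normalForm R w⟩

theorem exists_normalWord_snoc (R : TimedWord α → ℝ≥0) (w : TimedWord α) (t : ℝ≥0) (a : α) :
    ∃ n : ℕ, (normalWord R w).snoc n a = normalWord R (w ++ [(t, a)]) ∧
      RegionEq (R w + t) (hi (R w) + (n : ℝ≥0) / 2) := by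
  obtain ⟨⟨n, hn⟩, hreg⟩ := normalForm_delay_spec (R w) t
  refine ⟨n, Subtype.ext ?_, hn ▸ hreg⟩
  simp only [HIWord.coe_snoc, normalWord, normalForm_snoc, hn]

theorem IsResetFunction.apply_normalForm (hR : IsResetFunction R) {w : TimedWord α}
    (h : RegionEq (R w) (R (normalForm R w))) : R (normalForm R w) = hi (R w) := by
  exact h.hi_eq ▸ (hR.isHalfInteger (normalWord R w)).hi_eq.symm

end HalfIntegralWords

/-! ### The syntactic reset function -/

section SyntacticReset

variable {α : Type*} {L : Set (TimedWord α)} {u v : TimedWord α} {t : ℝ≥0}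

theorem residual_append (u v : TimedWord α) (L : Set (TimedWord α)) :
    residual (u ++ v) L = residual v (residual u L) :=
  Set.ext fun w => by simp only [residual, List.append_assoc, Set.mem_ofPred_eq]

theorem nil_mem_residual : [] ∈ residual u L ↔ u ∈ L := by
  rw [residual, Set.mem_ofPred_eq, List.append_nil]

theorem syntacticReset_eq_zero (h : Recognizable (residual u L)) : syntacticReset L u = 0 := by
  rcases List.eq_nil_or_concat' u with rfl | ⟨u, p, rfl⟩
  · rfl
  · rw [syntacticReset_snoc, if_pos h]

theorem syntacticReset_snoc_of_not {a : α} (h : ¬ Recognizable (residual (u ++ [(t, a)]) L)) :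
    syntacticReset L (u ++ [(t, a)]) = syntacticReset L u + t := by
  rw [syntacticReset_snoc, if_neg h]

/-- The residuals of `L` by `u` and `v` are accepted from one state of a finite clock machine,
started at the values of the syntactic reset function, and these values are region equivalent. This
invariant relates a word to its normal form. -/
structure SimilarReset (L : Set (TimedWord α)) (u v : TimedWord α) : Prop where
  regionEq : RegionEq (syntacticReset L u) (syntacticReset L v)
  exists_machine : ∃ (S : Type) (_ : Finite S) (M : ClockMachine α S) (s : S),
    residual u L = M.lang (s, syntacticReset L u) ∧ residual v L = M.lang (s, syntacticReset L v)

theorem similarReset_of_residual_eq (h : Recognizable (residual u L))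
    (heq : residual v L = residual u L) : SimilarReset L u v := by
  have hu := syntacticReset_eq_zero h
  have hv := syntacticReset_eq_zero (heq ▸ h)
  obtain ⟨S, hS, M, s, hM⟩ := h.exists_machine
  exact ⟨hu ▸ hv ▸ RegionEq.refl 0, S, hS, M, s, hu ▸ hM.symm, heq ▸ hv ▸ hM.symm⟩

theorem SimilarReset.mem_iff (h : SimilarReset L u v) : u ∈ L ↔ v ∈ L := by
  obtain ⟨S, _, M, s, hu, hv⟩ := h.exists_machine
  rw [← nil_mem_residual, ← nil_mem_residual (u := v), hu, hv]
  rfl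

variable [Finite α]

theorem SimilarReset.snoc (h : SimilarReset L u v) {t' : ℝ≥0} (a : α)
    (ht : RegionEq (syntacticReset L u + t) (syntacticReset L v + t')) :
    SimilarReset L (u ++ [(t, a)]) (v ++ [(t', a)]) := by
  obtain ⟨S, hS, M, s, hu, hv⟩ := h.exists_machine
  obtain ⟨r, b, hnext, hnext'⟩ := M.exists_next_eq_of_regionEq s a ht
  have hu' : residual (u ++ [(t, a)]) L =
      M.lang (r, if b = true then 0 else syntacticReset L u + t) := by
    rw [residual_append, hu, M.residual_lang]
    exact congrArg M.lang hnext
  have hv' : residual (v ++ [(t', a)]) L =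
      M.lang (r, if b = true then 0 else syntacticReset L v + t') := by
    rw [residual_append, hv, M.residual_lang]
    exact congrArg M.lang hnext'
  cases b with
  | true =>
    exact similarReset_of_residual_eq (hu' ▸ M.recognizable_lang_zero r) (hv'.trans hu'.symm)
  | false =>
    simp only [Bool.false_eq_true, if_false] at hu' hv'
    by_cases hrec : Recognizable (residual (u ++ [(t, a)]) L)
    · refine similarReset_of_residual_eq hrec ?_
      rw [hu'] at hrec
      rw [hu', hv', M.lang_eq_of_recognizable hrec ht]
    · have hrec' : ¬ Recognizable (residual (v ++ [(t', a)]) L) := by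
        rw [hu'] at hrec
        rw [hv']
        exact fun h => hrec (M.lang_eq_of_recognizable h ht.symm ▸ h)
      have hRu := syntacticReset_snoc_of_not hrec
      have hRv := syntacticReset_snoc_of_not hrec'
      exact ⟨by rwa [hRu, hRv], S, hS, M, r, by rw [hRu, hu'], by rw [hRv, hv']⟩

theorem Recognizable.similarReset_self (h : Recognizable L) (u : TimedWord α) :
    SimilarReset L u u := by
  induction u using List.reverseRecOn with
  | nil => exact similarReset_of_residual_eq h rfl
  | append_singleton u p ih => exact ih.snoc _ (RegionEq.refl _)

theorem Recognizable.similarReset_normalForm (h : Recognizable L) (u : TimedWord α) :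
    SimilarReset L u (normalForm (syntacticReset L) u) := by
  induction u using List.reverseRecOn with
  | nil => exact similarReset_of_residual_eq h rfl
  | append_singleton u p ih =>
    obtain ⟨t, a⟩ := p
    rw [normalForm_snoc]
    refine ih.snoc a ?_
    rw [(isResetFunction_syntacticReset L).apply_normalForm ih.regionEq]
    exact (normalForm_delay_spec _ _).2

theorem Recognizable.residual_of_reset_eq_natCast (h : Recognizable L) {n : ℕ}
    (hn : syntacticReset L u = n) : Recognizable (residual u L) := by
  obtain ⟨S, _, M, s, hM, -⟩ := (h.similarReset_self u).exists_machine
  rw [hM, hn]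
  exact M.recognizable_lang_natCast s n

theorem Recognizable.syntacticReset_snoc_eq_zero (h : Recognizable L) (a : α) {n : ℕ}
    (hn : syntacticReset L u + t = n) : syntacticReset L (u ++ [(t, a)]) = 0 := by
  by_contra hne
  have hrec : ¬ Recognizable (residual (u ++ [(t, a)]) L) := mt syntacticReset_eq_zero hne
  exact hrec (h.residual_of_reset_eq_natCast ((syntacticReset_snoc_of_not hrec).trans hn))

end SyntacticReset

/-! ### The syntactic profile of a recognizable language -/

section Machine

variable {α S : Type*} (M : ClockMachine α S) (s : S)

theorem ClockMachine.lang_next_eq_of_bound_lt {y t t' : ℝ≥0} (a : α)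
    (ht : (M.bound : ℝ≥0) < y + t) (ht' : (M.bound : ℝ≥0) < y + t') :
    M.lang (M.next (s, y) (t, a)) = M.lang (M.next (s, y) (t', a)) := by
  simp only [next, M.step_congr s a _ _ ((regionEqK_iff_lt ht).2 ht')]
  split_ifs
  · rfl
  · exact M.lang_eq_of_bound_lt _ ht ht'

theorem ClockMachine.recognizable_lang_next_of_bound_lt [Finite α] [Finite S] {y t : ℝ≥0} (a : α)
    (ht : (M.bound : ℝ≥0) < y + t) : Recognizable (M.lang (M.next (s, y) (t, a))) := by
  simp only [next]
  split_ifs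
  · exact M.recognizable_lang_zero _
  · exact M.recognizable_lang_of_bound_lt _ ht

theorem finite_range_residual [Finite S] :
    (Set.range fun u : HIWord α => residual u.1 (M.lang (s, 0))).Finite := by
  have hbounded : (M.lang '' (Set.univ ×ˢ {x | IsHalfInteger x ∧ x ≤ M.bound})).Finite :=
    (Set.finite_univ.prod (finite_setOf_isHalfInteger_le M.bound)).image _
  refine (hbounded.union (Set.finite_range fun r => M.lang (r, M.bound + 1))).subset ?_
  rintro _ ⟨u, rfl⟩
  simp only [M.residual_lang]
  rcases le_or_gt (M.run (s, 0) u.1).2 M.bound with hle | hlt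
  · exact Or.inl ⟨_, ⟨trivial, (M.isResetFunction_run s).isHalfInteger u, hle⟩, rfl⟩
  · exact Or.inr ⟨_, M.lang_eq_of_bound_lt _ (lt_add_one _) hlt⟩

variable [Finite α] [Finite S]

theorem syntacticReset_le_run (u : TimedWord α) :
    syntacticReset (M.lang (s, 0)) u ≤ (M.run (s, 0) u).2 := by
  induction u using List.reverseRecOn with
  | nil => exact le_rfl
  | append_singleton u p ih =>
    obtain ⟨t, a⟩ := p
    by_cases hrec : Recognizable (residual (u ++ [(t, a)]) (M.lang (s, 0)))
    · exact (syntacticReset_eq_zero hrec).trans_le zero_le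
    · rw [syntacticReset_snoc_of_not hrec, M.run_snoc]
      rw [M.residual_lang, M.run_snoc] at hrec
      simp only [ClockMachine.next] at hrec ⊢
      split_ifs at hrec ⊢
      · exact absurd (M.recognizable_lang_zero _) hrec
      · gcongr

theorem syntacticReset_le_bound (u : TimedWord α) :
    syntacticReset (M.lang (s, 0)) u ≤ M.bound := by
  by_contra! hlt
  have hrec : Recognizable (residual u (M.lang (s, 0))) := by
    rw [M.residual_lang]
    exact M.recognizable_lang_of_bound_lt _ (hlt.trans_le (syntacticReset_le_run M s u))
  exact not_lt_zero (syntacticReset_eq_zero hrec ▸ hlt)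

theorem syntacticProfile_C_bound : (syntacticProfile (M.lang (s, 0))).C M.bound := by
  intro u a n hn
  rcases hc : M.run (s, 0) u.1 with ⟨r, y⟩
  have hlt : (M.bound : ℝ≥0) < y + (n : ℝ≥0) / 2 :=
    hn.trans_le (by gcongr; exact (syntacticReset_le_run M s u.1).trans_eq (congrArg Prod.snd hc))
  have hlt' : (M.bound : ℝ≥0) < y + ((2 * M.bound + 1 : ℕ) : ℝ≥0) / 2 :=
    (natCast_lt_natCast_div_two (Nat.lt_succ_self _)).trans_le le_add_self
  have hres (k : ℕ) : residual (u.snoc k a).1 (M.lang (s, 0)) =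
      M.lang (M.next (r, y) ((k : ℝ≥0) / 2, a)) := by
    rw [M.residual_lang, HIWord.coe_snoc, M.run_snoc, hc]
  have hrec (k : ℕ) (hk : (M.bound : ℝ≥0) < y + (k : ℝ≥0) / 2) :
      syntacticReset (M.lang (s, 0)) (u.snoc k a).1 = 0 :=
    syntacticReset_eq_zero (hres k ▸ M.recognizable_lang_next_of_bound_lt r a hk)
  exact ⟨(hrec _ hlt).trans (hrec _ hlt').symm,
    (hres _).trans ((M.lang_next_eq_of_bound_lt r a hlt hlt').trans (hres _).symm)⟩

theorem finite_range_syntacticReset :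
    (Set.range fun u : HIWord α => syntacticReset (M.lang (s, 0)) u.1).Finite := by
  refine (finite_setOf_isHalfInteger_le M.bound).subset ?_
  rintro _ ⟨u, rfl⟩
  exact ⟨(isResetFunction_syntacticReset _).isHalfInteger u, syntacticReset_le_bound M s u.1⟩

theorem finite_quotient_syntacticProfile :
    Finite (Quotient (syntacticProfile (M.lang (s, 0))).rel) := by
  have := (finite_range_syntacticReset M s).to_subtype
  have := (finite_range_residual M s).to_subtype
  let classify (q : Quotient (syntacticProfile (M.lang (s, 0))).rel) :
      Set.range (fun u : HIWord α => syntacticReset (M.lang (s, 0)) u.1) ×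
        Set.range (fun u : HIWord α => residual u.1 (M.lang (s, 0))) :=
    (Set.rangeFactorization _ q.out, Set.rangeFactorization _ q.out)
  refine Finite.of_injective classify fun q q' h => Quotient.out_equiv_out.1 ?_
  exact ⟨congrArg (fun p => p.1.1) h, congrArg (fun p => p.2.1) h⟩

end Machine

namespace Profile

variable {α : Type*} {P : Profile α}

theorem constant_le {K : ℕ} (h : P.C K) : P.constant ≤ K := sInf_le ⟨K, h, rfl⟩

theorem C_toNat_constant (h : P.constant < ⊤) : P.C P.constant.toNat := by
  have hne : ((fun K : ℕ => (K : ℕ∞)) '' {K | P.C K}).Nonempty :=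
    (sInf_lt_iff.1 h).imp fun _ hK => hK.1
  obtain ⟨K, hK, heq⟩ := csInf_mem hne
  have heq : (K : ℕ∞) = P.constant := heq
  rwa [← heq, ENat.toNat_natCast]

end Profile

section Syntactic

variable {α : Type*} {L : Set (TimedWord α)}

theorem syntacticProfile_rel_iff {u v : HIWord α} : (syntacticProfile L).rel u v ↔
    syntacticReset L u.1 = syntacticReset L v.1 ∧ residual u.1 L = residual v.1 L := Iff.rfl

theorem syntacticProfile_rel_snoc {u v : HIWord α} (h : (syntacticProfile L).rel u v) (n : ℕ)
    (a : α) : (syntacticProfile L).rel (u.snoc n a) (v.snoc n a) := by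
  obtain ⟨hreset, hresidual⟩ := syntacticProfile_rel_iff.1 h
  have hsnoc : residual (u.snoc n a).1 L = residual (v.snoc n a).1 L := by
    simp only [HIWord.coe_snoc, residual_append, hresidual]
  refine ⟨?_, hsnoc⟩
  simp only [HIWord.coe_snoc, syntacticReset_snoc] at hsnoc ⊢
  rw [hreset, hsnoc]

variable [Finite α]

theorem Recognizable.preserving (h : Recognizable L) : (syntacticProfile L).Preserving L where
  mem_iff_of_rel u v huv := by
    rw [← nil_mem_residual, ← nil_mem_residual (u := v.1), (syntacticProfile_rel_iff.1 huv).2]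
  mem_iff_normalForm w := (h.similarReset_normalForm w).mem_iff

theorem Recognizable.monotonic (h : Recognizable L) : (syntacticProfile L).Monotonic where
  regionEq u v huv := by
    have hreset : (syntacticProfile L).R u.1 = (syntacticProfile L).R v.1 := huv.1
    exact hreset ▸ (RegionEq.refl _).regionEqK
  snoc _ _ huv := syntacticProfile_rel_snoc huv
  regionEq_normalForm u := (h.similarReset_normalForm u).regionEq

theorem Recognizable.finiteIndex (h : Recognizable L) : (syntacticProfile L).FiniteIndex := by
  obtain ⟨S, _, M, s, rfl⟩ := h.exists_machine
  exact ⟨finite_quotient_syntacticProfile M s,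
    (Profile.constant_le (syntacticProfile_C_bound M s)).trans_lt (ENat.natCast_lt_top _)⟩

end Syntactic

/-! ### The automaton of a profile -/

namespace Profile

variable {α : Type*} {P : Profile α} {L : Set (TimedWord α)}

theorem Monotonic.eq_zero_iff (hm : P.Monotonic) {u v : HIWord α} (h : P.rel u v) :
    P.R u.1 = 0 ↔ P.R v.1 = 0 :=
  (hm.regionEq u v h).eq_zero_iff

theorem Monotonic.regionEqK_toNat (hm : P.Monotonic) (hK : P.constant < ⊤) {u v : HIWord α}
    (h : P.rel u v) : RegionEqK (P.constant.toNat : ℕ∞) (P.R u.1) (P.R v.1) := by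
  rw [ENat.natCast_toNat hK.ne]
  exact hm.regionEq u v h

theorem Monotonic.rel_snoc_of_regionEqK (hm : P.Monotonic) (hK : P.constant < ⊤) {u v : HIWord α}
    (h : P.rel u v) (a : α) {m n : ℕ} (hreg : RegionEqK (P.constant.toNat : ℕ∞)
      (P.R u.1 + (m : ℝ≥0) / 2) (P.R v.1 + (n : ℝ≥0) / 2)) :
    P.rel (u.snoc m a) (v.snoc n a) := by
  have hC := P.C_toNat_constant hK
  have rel_of_lt (hu : (P.constant.toNat : ℝ≥0) < P.R u.1 + (m : ℝ≥0) / 2)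
      (hv : (P.constant.toNat : ℝ≥0) < P.R v.1 + (n : ℝ≥0) / 2) :
      P.rel (u.snoc m a) (v.snoc n a) :=
    P.rel.trans (hC u a m hu) (P.rel.trans (hm.snoc u v h _ a) (P.rel.symm (hC v a n hv)))
  rcases regionEqK_natCast_iff.1 hreg with hsum | ⟨hu, hv⟩
  · have hRu := P.isReset.isHalfInteger u
    have hRv := P.isReset.isHalfInteger v
    rcases regionEqK_natCast_iff.1 (hm.regionEqK_toNat hK h) with hR | ⟨hu, hv⟩
    · have hadd := (hRu.add (isHalfInteger_natCast_div_two m)).eq_of_regionEq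
        (hRv.add (isHalfInteger_natCast_div_two n)) hsum
      rw [hRu.eq_of_regionEq hRv hR, add_right_inj, div_left_inj' two_ne_zero, Nat.cast_inj] at hadd
      exact hadd ▸ hm.snoc u v h m a
    · exact rel_of_lt (hu.trans_le le_self_add) (hv.trans_le le_self_add)
  · exact rel_of_lt hu hv

theorem exists_isRun_automaton
    (hP : ∀ u : TimedWord α, RegionEq (P.R u) (P.R (normalForm P.R u))) (w : TimedWord α) :
    ∃ e, (P.automaton L).IsRun ((P.automaton L).init, 0) w e
      (Quotient.mk P.rel (normalWord P.R w), P.R w) := by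
  refine TA.exists_isRun_of_forall_move
    (f := fun w => (Quotient.mk P.rel (normalWord P.R w), P.R w)) ?_ (fun w p => ?_) w
  · exact Prod.ext rfl P.isReset.1
  obtain ⟨t, a⟩ := p
  obtain ⟨n, hsnoc, hreg⟩ := exists_normalWord_snoc P.R w t a
  classical
  refine ⟨⟨Quotient.mk P.rel (normalWord P.R w), Quotient.mk P.rel (normalWord P.R (w ++ [(t, a)])),
    a, regionGuard P.constant.toNat (P.R (normalWord P.R w).1 + (n : ℝ≥0) / 2),
    decide (P.R (w ++ [(t, a)]) = 0)⟩, ?_⟩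
  refine ⟨⟨_, _, n, hsnoc ▸ P.rel.refl _, rfl, rfl, rfl, ?_⟩, rfl, rfl, ?_, Prod.ext rfl ?_⟩
  · rw [decide_eq_true_iff]
    exact (hP _).eq_zero_iff
  · rw [mem_regionGuard, normalWord, P.isReset.apply_normalForm (hP w)]
    exact hreg.symm.regionEqK
  · simp only [decide_eq_true_iff]
    split_ifs with hzero
    · exact hzero
    · exact (P.isReset.2 w t a).resolve_left hzero

theorem deterministic_automaton (hm : P.Monotonic) (hK : P.constant < ⊤) :
    (P.automaton L).Deterministic := by
  rintro ⟨_, _, a, _, b⟩ ⟨u, v, n, hv, rfl, rfl, rfl, hb⟩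
    ⟨_, _, a', _, b'⟩ ⟨u', v', n', hv', rfl, rfl, rfl, hb'⟩ hne
  by_contra! hcon
  obtain ⟨hu, ha, x, hx, hx'⟩ := hcon
  obtain rfl : a = a' := ha
  have hreg := (mem_regionGuard.1 hx).trans (mem_regionGuard.1 hx').symm
  have hvv' : P.rel v v' :=
    P.rel.trans (P.rel.symm hv)
      (P.rel.trans (hm.rel_snoc_of_regionEqK hK (Quotient.exact hu) a hreg) hv')
  have hbb' : b = b' := Bool.eq_iff_iff.2 (hb.trans ((hm.eq_zero_iff hvv').trans hb'.symm))
  exact hne (by rw [Transition.mk.injEq]; exact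
    ⟨hu, Quotient.sound hvv', rfl, regionGuard_congr hreg, hbb'⟩)

theorem isDTA_automaton [Finite α] (hm : P.Monotonic) (hf : P.FiniteIndex) :
    (P.automaton L).IsDTA where
  finite_states := hf.finite_quotient
  finite_trans := by
    have := hf.finite_quotient
    exact (finite_setOf_guard_mem (finite_range_regionGuard P.constant.toNat)).subset
      fun _ ⟨_, _, _, _, _, _, hguard, _⟩ => ⟨_, hguard.symm⟩
  deterministic := deterministic_automaton hm hf.constant_lt_top

theorem maxConst_automaton (hfin : (P.automaton L).trans.Finite) :
    (P.automaton L).maxConst = P.constant.toNat := by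
  apply le_antisymm
  · refine csSup_le' ?_
    rintro _ ⟨⟨_, _, _, _, _⟩, ⟨_, _, _, _, _, _, rfl, _⟩, rfl⟩
    exact maxConst_regionGuard_le
  rcases isEmpty_or_nonempty α with hα | ⟨⟨a⟩⟩
  · have hzero : P.constant ≤ (0 : ℕ) := P.constant_le fun _ a => hα.elim a
    simp [nonpos_iff_eq_zero.1 hzero]
  · let x : ℝ≥0 := P.R (HIWord.nil : HIWord α).1 + ((2 * P.constant.toNat + 1 : ℕ) : ℝ≥0) / 2
    have hlt : (P.constant.toNat : ℝ≥0) < x :=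
      (natCast_lt_natCast_div_two (Nat.lt_succ_self _)).trans_le le_add_self
    classical
    let v : HIWord α := HIWord.nil.snoc (2 * P.constant.toNat + 1) a
    let θ : Transition α (Quotient P.rel) := ⟨Quotient.mk P.rel HIWord.nil, Quotient.mk P.rel v, a,
      regionGuard P.constant.toNat x, decide (P.R v.1 = 0)⟩
    have hθ : θ ∈ (P.automaton L).trans :=
      ⟨_, v, _, P.rel.refl v, rfl, rfl, rfl, decide_eq_true_iff⟩
    have hguard : θ.guard.maxConst = P.constant.toNat := by
      simp only [θ, regionGuard, if_neg hlt.not_ge, ClockConstraint.maxConst]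
    exact hguard ▸ TA.maxConst_le_of_mem hfin hθ

theorem language_automaton (hp : P.Preserving L) (hm : P.Monotonic) (hK : P.constant < ⊤) :
    (P.automaton L).language = L := by
  ext w
  obtain ⟨e, he⟩ := exists_isRun_automaton (L := L) hm.regionEq_normalForm w
  rw [he.mem_language_iff (deterministic_automaton hm hK), hp.mem_iff_normalForm w]
  exact ⟨fun ⟨u, hu, h⟩ => (hp.mem_iff_of_rel _ _ (Quotient.exact h)).2 hu,
    fun h => ⟨normalWord P.R w, h, rfl⟩⟩

theorem isAcceptor_automaton [Finite α] (hm : P.Monotonic) (hf : P.FiniteIndex) :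
    (P.automaton L).IsAcceptor where
  isDTA := isDTA_automaton hm hf
  complete w := by
    obtain ⟨e, he⟩ := exists_isRun_automaton (L := L) hm.regionEq_normalForm w
    exact ⟨e, ⟨_, he⟩, fun e' ⟨_, hc⟩ =>
      (hc.unique (deterministic_automaton hm hf.constant_lt_top) he).1⟩
  guard_region := by
    rintro ⟨_, _, _, _, _⟩ ⟨_, _, _, _, _, _, rfl, _⟩
    rw [maxConst_automaton (isDTA_automaton hm hf).finite_trans]
    exact isRegion_regionGuard
  state_region := by
    refine ⟨fun q => {z | RegionEqK ((P.automaton L).maxConst : ℕ∞) (P.R q.out.1) z},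
      fun q => ⟨_, rfl⟩, fun w e q y h => ?_⟩
    obtain ⟨e', he'⟩ := exists_isRun_automaton (L := L) hm.regionEq_normalForm w
    obtain ⟨rfl, rfl⟩ := Prod.ext_iff.1
      (h.unique (deterministic_automaton hm hf.constant_lt_top) he').2
    rw [maxConst_automaton (isDTA_automaton hm hf).finite_trans]
    have hout := hm.regionEqK_toNat hf.constant_lt_top (Quotient.mk_out (normalWord P.R w))
    exact hout.trans (hm.regionEq_normalForm w).symm.regionEqK

theorem isStrictAcceptor_automaton [Finite α] (hm : P.Monotonic) (hf : P.FiniteIndex)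
    (hreset : ∀ (u : HIWord α) (n : ℕ) (a : α) (m : ℕ), P.R u.1 + (n : ℝ≥0) / 2 = m →
      P.R (u.snoc n a).1 = 0) :
    (P.automaton L).IsStrictAcceptor where
  toIsAcceptor := isAcceptor_automaton hm hf
  strict := by
    rintro ⟨_, _, a, _, b⟩ ⟨u, v, n, hv, rfl, rfl, rfl, hb⟩ m hguard
    have hmem : P.R u.1 + (n : ℝ≥0) / 2 ∈ ({(m : ℝ≥0)} : Set ℝ≥0) := hguard ▸ self_mem_regionGuard
    exact hb.2 ((hm.eq_zero_iff hv).1 (hreset u n a m hmem))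

end Profile

theorem Recognizable.isStrictAcceptor_canonicalAcceptor {α : Type*} [Finite α]
    {L : Set (TimedWord α)} (h : Recognizable L) : (canonicalAcceptor L).IsStrictAcceptor :=
  Profile.isStrictAcceptor_automaton h.monotonic h.finiteIndex
    fun _ _ a _ hm => h.syntacticReset_snoc_eq_zero a hm

/-! ### Minimality -/

section Minimality

variable {α Q : Type*} {B : TA α Q} {w : TimedWord α} {u v : HIWord α}
  {e e' : List (Transition α Q)} {q : Q} {y y' : ℝ≥0}

theorem TA.IsStrictAcceptor.eq_zero_of_isRun_natCast (hB : B.IsStrictAcceptor) {m : ℕ}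
    (h : B.IsRun (B.init, 0) w e (q, (m : ℝ≥0))) (hm : m ≤ B.maxConst) : m = 0 := by
  rcases List.eq_nil_or_concat' w with rfl | ⟨w, p, rfl⟩
  · exact Nat.cast_eq_zero.1 (Prod.ext_iff.1 (TA.isRun_nil_iff.1 h).2).2
  obtain ⟨-, c, θ, -, hθ⟩ := h.exists_of_snoc
  have hclock : (m : ℝ≥0) = if θ.resets = true then 0 else c.2 + p.1 :=
    (Prod.ext_iff.1 hθ.target).2
  split_ifs at hclock with hresets
  · exact Nat.cast_eq_zero.1 hclock
  have hguard : θ.guard.denote = {(m : ℝ≥0)} :=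
    (hB.guard_region θ hθ.mem).eq_singleton_of_natCast_mem (hclock ▸ hθ.guard) hm
  exact absurd (hB.strict θ hθ.mem m hguard) hresets

variable [Finite α]

theorem TA.IsDTA.recognizable_residual_of_natCast (hB : B.IsDTA) {n : ℕ}
    (h : B.IsRun (B.init, 0) w e (q, (n : ℝ≥0))) : Recognizable (residual w B.language) := by
  have := hB.finite_states
  rw [h.residual_language hB]
  exact hB.machine.recognizable_lang_natCast _ n

theorem TA.IsDTA.recognizable_residual_of_maxConst_lt (hB : B.IsDTA)
    (h : B.IsRun (B.init, 0) w e (q, y)) (hy : (B.maxConst : ℝ≥0) < y) :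
    Recognizable (residual w B.language) := by
  have := hB.finite_states
  rw [h.residual_language hB]
  exact hB.machine.recognizable_lang_of_bound_lt _ hy

-- Where the residual by a prefix is recognizable, `R^L` is zero. There the clock of `B` is an
-- integer, because its value and that of `R^L` after one more delay are half-integral but not
-- integral; and in a strict acceptor an integral clock value is zero.
theorem TA.IsStrictAcceptor.clock_eq_syntacticReset (hB : B.IsStrictAcceptor)
    (h : B.IsRun (B.init, 0) u.1 e (q, y)) (hrec : ¬ Recognizable (residual u.1 B.language)) :
    y = syntacticReset B.language u.1 := by
  induction u using HIWord.induction generalizing e q y with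
  | nil => exact (Prod.ext_iff.1 (TA.isRun_nil_iff.1 h).2).2
  | snoc u n a ih =>
    have hL : Recognizable B.language := hB.isDTA.recognizable_language
    have hy_le : y ≤ B.maxConst :=
      not_lt.1 (mt (hB.isDTA.recognizable_residual_of_maxConst_lt h) hrec)
    have hy_nat (m : ℕ) : y ≠ m := fun hm =>
      hrec (hB.isDTA.recognizable_residual_of_natCast (hm ▸ h))
    have hR_nat (m : ℕ) : syntacticReset B.language (u.snoc n a).1 ≠ m :=
      mt hL.residual_of_reset_eq_natCast hrec
    obtain ⟨e', ⟨q', y'⟩, θ, hrun, hθ⟩ := h.exists_of_snoc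
    have hy : y = y' + (n : ℝ≥0) / 2 := by
      have hclock := (Prod.ext_iff.1 hθ.target).2
      split_ifs at hclock
      · exact absurd (hclock.trans Nat.cast_zero.symm) (hy_nat 0)
      · exact hclock
    have hR : syntacticReset B.language (u.snoc n a).1 =
        syntacticReset B.language u.1 + (n : ℝ≥0) / 2 := syntacticReset_snoc_of_not hrec
    suffices hy' : y' = syntacticReset B.language u.1 by rw [hy, hR, hy']
    by_cases hu : Recognizable (residual u.1 B.language)
    · have hRu := syntacticReset_eq_zero hu
      rw [hR, hRu, zero_add] at hR_nat
      obtain ⟨m, rfl⟩ := (hrun.isHalfInteger hB.isDTA).eq_natCast_of_add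
        (isHalfInteger_natCast_div_two n) hR_nat (hy ▸ hy_nat)
      have hm : m ≤ B.maxConst := Nat.cast_le.1 ((le_self_add.trans_eq hy.symm).trans hy_le)
      rw [hRu, hB.eq_zero_of_isRun_natCast hrun hm, Nat.cast_zero]
    · exact ih hrun hu

theorem TA.IsStrictAcceptor.syntacticProfile_rel_of_isRun (hB : B.IsStrictAcceptor)
    (hu : B.IsRun (B.init, 0) u.1 e (q, y)) (hv : B.IsRun (B.init, 0) v.1 e' (q, y')) :
    (syntacticProfile B.language).rel u v := by
  have hA := hB.isDTA
  obtain ⟨region, hregion, hmem⟩ := hB.state_region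
  have hyy' : RegionEqK (B.maxConst : ℕ∞) y y' :=
    ((hregion q).eq_setOf_of_mem (hmem _ _ _ _ hu)).subset (hmem _ _ _ _ hv)
  have hclock : y = y' ∨ ((B.maxConst : ℝ≥0) < y ∧ (B.maxConst : ℝ≥0) < y') :=
    (regionEqK_natCast_iff.1 hyy').imp_left
      ((hu.isHalfInteger hA).eq_of_regionEq (hv.isHalfInteger hA))
  have hresidual : residual u.1 B.language = residual v.1 B.language := by
    rw [hu.residual_language hA, hv.residual_language hA]
    rcases hclock with rfl | ⟨hlt, hlt'⟩
    · rfl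
    · exact hA.machine.lang_eq_of_bound_lt _ hlt hlt'
  refine syntacticProfile_rel_iff.2 ⟨?_, hresidual⟩
  by_cases hrec : Recognizable (residual u.1 B.language)
  · rw [syntacticReset_eq_zero hrec, syntacticReset_eq_zero (hresidual ▸ hrec)]
  · have hlt := mt (hA.recognizable_residual_of_maxConst_lt hu) hrec
    obtain rfl : y = y' := hclock.resolve_right fun h => hlt h.1
    rw [← hB.clock_eq_syntacticReset hu hrec,
      ← hB.clock_eq_syntacticReset hv (hresidual ▸ hrec)]

theorem TA.IsStrictAcceptor.card_canonicalState_le (hB : B.IsStrictAcceptor) :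
    Nat.card (CanonicalState B.language) ≤ Nat.card Q := by
  have := hB.isDTA.finite_states
  have hrun (w : TimedWord α) : ∃ q e y, B.IsRun (B.init, 0) w e (q, y) := by
    obtain ⟨e, ⟨c, h⟩, -⟩ := hB.complete w
    exact ⟨c.1, e, c.2, h⟩
  choose state e y hrun using hrun
  refine Nat.card_le_card_of_injective
    (fun s : CanonicalState B.language => state s.out.1) fun s s' hs => Quotient.out_equiv_out.1 ?_
  have hs : state s.out.1 = state s'.out.1 := hs
  exact hB.syntacticProfile_rel_of_isRun (hs ▸ hrun s.out.1) (hrun s'.out.1)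

theorem TA.IsDTA.maxConst_canonicalAcceptor_le (hB : B.IsDTA) :
    (canonicalAcceptor B.language).maxConst ≤ B.maxConst := by
  have hL : Recognizable B.language := hB.recognizable_language
  have := hB.finite_states
  have hC : (syntacticProfile B.language).C B.maxConst :=
    TA.lang_machine hB ▸ syntacticProfile_C_bound hB.machine (some B.init)
  rw [canonicalAcceptor, Profile.maxConst_automaton
    (Profile.isDTA_automaton hL.monotonic hL.finiteIndex).finite_trans]
  exact ENat.toNat_le_of_le_natCast (Profile.constant_le hC)

end Minimality

end OneClock

theorem theorem3_general {α : Type*} [Finite α] (L : Set (OneClock.TimedWord α)) :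
    (OneClock.Recognizable L ↔
      (OneClock.syntacticProfile L).Preserving L ∧ (OneClock.syntacticProfile L).Monotonic ∧
        (OneClock.syntacticProfile L).FiniteIndex) ∧
    (OneClock.Recognizable L →
      (OneClock.canonicalAcceptor L).IsStrictAcceptor ∧
        (OneClock.canonicalAcceptor L).language = L) ∧
    (∀ (Q : Type*) (B : OneClock.TA α Q), B.IsDTA → B.language = L →
      (B.IsStrictAcceptor → Nat.card (OneClock.CanonicalState L) ≤ Nat.card Q) ∧
        (OneClock.canonicalAcceptor L).maxConst ≤ B.maxConst) := by
  refine ⟨⟨fun h => ⟨h.preserving, h.monotonic, h.finiteIndex⟩, fun ⟨hp, hm, hf⟩ => ?_⟩,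
    fun h => ⟨h.isStrictAcceptor_canonicalAcceptor, OneClock.Profile.language_automaton
      h.preserving h.monotonic h.finiteIndex.constant_lt_top⟩, ?_⟩
  · rw [← OneClock.Profile.language_automaton hp hm hf.constant_lt_top]
    exact (OneClock.Profile.isDTA_automaton hm hf).recognizable_language
  · rintro Q B hB rfl
    exact ⟨fun hstrict => hstrict.card_canonicalState_le, hB.maxConst_canonicalAcceptor_le⟩

theorem theorem3 {α : Type*} [Finite α] (L : Set (OneClock.TimedWord α)) :
    -- (a) the characterization
    (OneClock.Recognizable L ↔
      (OneClock.syntacticProfile L).Preserving L ∧ (OneClock.syntacticProfile L).Monotonic ∧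
        (OneClock.syntacticProfile L).FiniteIndex) ∧
    -- the canonical acceptor is a strict acceptor for `L`
    (OneClock.Recognizable L →
      (OneClock.canonicalAcceptor L).IsStrictAcceptor ∧
        (OneClock.canonicalAcceptor L).language = L) ∧
    -- (b) it is minimal among the strict acceptors for `L`, in states and in constant
    (∀ (Q : Type*) (B : OneClock.TA α Q), B.IsStrictAcceptor → B.language = L →
      Nat.card (OneClock.CanonicalState L) ≤ Nat.card Q ∧
        (OneClock.canonicalAcceptor L).maxConst ≤ B.maxConst) := by
  obtain ⟨hchar, hcanonical, hmin⟩ := theorem3_general L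
  exact ⟨hchar, hcanonical, fun Q B hB hL => (hmin Q B hB.isDTA hL).imp_left (· hB)⟩
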